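/- **Setting.** Let $\mathcal D\subset\mathbb R^2$ be a finite set, $n$ a number of robots, $m:\mathcal D\to\mathbb R$ and $k:\mathcal D\times\mathcal D\to\mathbb R$ with $k\le 1$, $\sigma>0$, $\delta\in(0,1]$, and $\beta_t=2\log\!\big(|\mathcal D|\,t^2\pi^2/(6\delta)\big)$. The density $f$ is the realization of a Gaussian process on $\mathcal D$ with mean $m$ and covariance function $k$. For positions $\mathbf x=(x^1,\dots,x^n)\in\mathcal D^n$ and $g:\mathcal D\to\mathbb R$ the locational cost is $\ell(g,\mathbf x)=\sum_{i=1}^n\sum_{q\in\mathcal V^i}\|q-x^i\|_2^2\,g(q)$, where $\mathcal V^1,\dots,\mathcal V^n$ is the Voronoi partition of $\mathcal D$ generated by $\mathbf x$ (each point of $\mathcal D$ is assigned to exactly one nearest robot). **Algorithm (ORC).** The initial positions $\mathbf x_0$ are random and independent of $f$ and of all noises. Let $\mu_0,\sigma_0$ be the prior mean and standard deviation. At each time $t=1,2,\dots$, using only $\mathbf x_0$ and the earlier measurements, the robots form the surrogate $\hat f_t=\mu_{t-1}-\sqrt{\beta_t}\,\sigma_{t-1}$; the control law brings them to a global minimizer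 $\mathbf x_t$ of $\ell(\hat f_t,\cdot)$ over $\mathcal D^n$; an additional location $\tilde x_t\in\arg\max_{q\in\mathcal D}\sigma_{t-1}(q)$ is chosen; the values of $f$ at $x_t^1,\dots,x_t^n,\tilde x_t$ are measured with i.i.d. $\mathcal N(0,\sigma^2)$ noise independent of $f$; and $\mu_t,\sigma_t$ are updated from all measurements so far. The update is one of the following, where $\phi_{\mathbf v}(x)=p^{-1/2}\big(\sin\mathbf v_i^\top x,\cos\mathbf v_i^\top x\big)_{i\le p}$ is the random feature vector of given frequencies $\mathbf v_1,\dots,\mathbf v_p$ and $s>0$: 1. *GP*: exact Gaussian process regression (posterior mean and standard deviation) with prior mean $m$, kernel $k$ and noise variance $\sigma^2$; 2. *RFGP*, in the case $m=0$, $k(x,x')=s^2\phi_{\mathbf v}(x)^\top\phi_{\mathbf v}(x')$: with $\Phi_t$ the matrix whose rows are the features of the locations sampled up to time $t$ and $y_{:t}$ the measurements, $\mu_t(x)=\phi_{\mathbf v}(x)^\top\big(\Phi_t^\top\Phi_t+\tfrac{\sigma^2}{s^2}I\big)^{-1}\Phi_t^\top y_{:t}$ and $\sigma_t^2(x)=\phi_{\mathbf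 v}(x)^\top\big(\tfrac1{\sigma^2}\Phi_t^\top\Phi_t+\tfrac1{s^2}I\big)^{-1}\phi_{\mathbf v}(x)$; 3. *O-RFGP*, in the case $m(x)=\phi_{\mathbf v}(x)^\top\theta_0$, $k(x,x')=s^2\phi_{\mathbf v}(x)^\top\phi_{\mathbf v}(x')$: $\mu_t(x)=\phi_{\mathbf v}(x)^\top\theta_t$, $\sigma_t^2(x)=\phi_{\mathbf v}(x)^\top\Sigma_t\phi_{\mathbf v}(x)$, $\Sigma_0=s^2I$, and, with $\Psi_t$ the matrix whose columns are the features of the $n+1$ locations of time $t$, $y_t$ their measurements and $S_t=\Psi_t^\top\Sigma_{t-1}\Psi_t+\sigma^2I$, $$\theta_t=\theta_{t-1}+\Sigma_{t-1}\Psi_tS_t^{-1}(y_t-\Psi_t^\top\theta_{t-1}),\qquad \Sigma_t=\Sigma_{t-1}-\Sigma_{t-1}\Psi_tS_t^{-1}\Psi_t^\top\Sigma_{t-1}.$$ **Quantities.** Let $R_T=\sum_{t=1}^T\big(\ell(f,\mathbf x_t)-\min_{\mathbf x\in\mathcal D^n}\ell(f,\mathbf x)\big)$ be the cumulative regret, $c_1=8|\mathcal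 D|^2\max_{x,x'\in\mathcal D}\dfrac{\|x-x'\|_2^4}{\log(1+\sigma^{-2})}$, and let $\gamma_T=\max_A I(y_A;f_A)$ be the maximum information gain, where the maximum is over all sequences $A$ of $T$ points of $\mathcal D$ (repetitions allowed), $f_A$ is the vector of values of $f$ along $A$, $y_A$ is $f_A$ plus independent $\mathcal N(0,\sigma^2)$ noise, and $I$ is mutual information. **Theorem 1.** With probability at least $1-\delta$, for all $T\ge1$, $$R_T\le\sqrt{c_1\,(n+1)\,T\,\beta_T\,\gamma_T},$$ and moreover, on the same event, if $\gamma_T=\mathcal O(T)$ (in particular, whenever $\gamma_T$ grows sublinearly), the algorithm is asymptotically no-regret: $\lim_{T\to\infty}R_T/T=0$. -/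

import Mathlib

open MeasureTheory ProbabilityTheory Filter Topology
open scoped Matrix

namespace ORC

noncomputable section

/-- The plane `ℝ²` with its Euclidean norm. -/
abbrev Plane : Type := EuclideanSpace ℝ (Fin 2)

/-! ### Coverage -/

/-- The Voronoi cell of robot `i`: the points of the domain to which no other robot is closer. -/
def voronoiCell {D : Finset Plane} {n : ℕ} (x : Fin n → D) (i : Fin n) : Set D :=
  {q | ∀ j, j ≠ i → ‖(q : Plane) - x i‖ ≤ ‖(q : Plane) - x j‖}

/-- The region of dominance of robot `i`: its Voronoi cell, where a point that lies in several
cells is given to the robot of lowest index, so that the regions partition the domain (on a finite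
domain ties are not negligible). -/
def region {D : Finset Plane} {n : ℕ} (x : Fin n → D) (i : Fin n) : Set D :=
  {q | q ∈ voronoiCell x i ∧ ∀ j, j < i → q ∉ voronoiCell x j}

open Classical in
/-- The locational cost of the robot positions `x` for the density `f` on the finite domain. -/
def cost {D : Finset Plane} {n : ℕ} (f : D → ℝ) (x : Fin n → D) : ℝ :=
  ∑ i, ∑ q : D, if q ∈ region x i then ‖(q : Plane) - x i‖ ^ 2 * f q else 0

/-- The regret of the positions `x`. -/
def regret {D : Finset Plane} {n : ℕ} (f : D → ℝ) (x : Fin n → D) : ℝ :=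
  cost f x - ⨅ x' : Fin n → D, cost f x'

/-- The cumulative regret `R_T` of a sequence of positions at times `1, …, T`. -/
def cumRegret {D : Finset Plane} {n : ℕ} (f : D → ℝ) (x : ℕ → Fin n → D) (T : ℕ) : ℝ :=
  ∑ t ∈ Finset.Icc 1 T, regret f (x t)

/-! ### Estimation

Measurements are indexed by a time `1, 2, …` and by `Option (Fin n)`: `some i` is the measurement
of robot `i`, `none` the additional one. `z t o` is a location and `y t o` a measured value. -/

/-- Indices of the measurements at times `1, …, t`; `(j, o)` refers to time `j + 1`. -/
abbrev DataIdx (n t : ℕ) : Type := Fin t × Option (Fin n)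

/-- The kernel matrix of the locations sampled at times `1, …, t`. -/
def kernelMatrix {D : Finset Plane} {n : ℕ} (k : D → D → ℝ) (z : ℕ → Option (Fin n) → D) (t : ℕ) :
    Matrix (DataIdx n t) (DataIdx n t) ℝ :=
  Matrix.of fun a b => k (z (a.1 + 1) a.2) (z (b.1 + 1) b.2)

/-- The vector of kernel values between `q` and the locations sampled at times `1, …, t`. -/
def kernelVector {D : Finset Plane} {n : ℕ} (k : D → D → ℝ) (z : ℕ → Option (Fin n) → D) (t : ℕ)
    (q : D) : DataIdx n t → ℝ :=
  fun a => k (z (a.1 + 1) a.2) q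

/-- Gaussian process posterior mean after the measurements at times `1, …, t`, for the prior mean
`m`, the kernel `k` and the noise variance `σ ^ 2`. -/
def gpMean {D : Finset Plane} {n : ℕ} (m : D → ℝ) (k : D → D → ℝ) (σ : ℝ)
    (z : ℕ → Option (Fin n) → D) (y : ℕ → Option (Fin n) → ℝ) (t : ℕ) (q : D) : ℝ :=
  m q + kernelVector k z t q ⬝ᵥ ((kernelMatrix k z t + σ ^ 2 • 1)⁻¹ *ᵥ
    fun a => y (a.1 + 1) a.2 - m (z (a.1 + 1) a.2))

/-- Gaussian process posterior variance. -/
def gpVar {D : Finset Plane} {n : ℕ} (k : D → D → ℝ) (σ : ℝ)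
    (z : ℕ → Option (Fin n) → D) (t : ℕ) (q : D) : ℝ :=
  k q q - kernelVector k z t q ⬝ᵥ
    ((kernelMatrix k z t + σ ^ 2 • 1)⁻¹ *ᵥ kernelVector k z t q)

/-- Index set of the `2p` random features (`inl` for the sines, `inr` for the cosines). -/
abbrev FeatIdx (p : ℕ) : Type := Fin p ⊕ Fin p

/-- The random feature vector `p^{-1/2} (sin ⟨v_i, x⟩, cos ⟨v_i, x⟩)_i` for frequencies `v`. -/
def feature {p : ℕ} (v : Fin p → Plane) (x : Plane) : FeatIdx p → ℝ :=
  Sum.elim (fun i => (√(p : ℝ))⁻¹ * Real.sin (inner ℝ (v i) x))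
    (fun i => (√(p : ℝ))⁻¹ * Real.cos (inner ℝ (v i) x))

/-- The matrix whose rows are the features of the locations sampled at times `1, …, t`. -/
def featureMatrix {D : Finset Plane} {n p : ℕ} (v : Fin p → Plane) (z : ℕ → Option (Fin n) → D)
    (t : ℕ) : Matrix (DataIdx n t) (FeatIdx p) ℝ :=
  Matrix.of fun a => feature v (z (a.1 + 1) a.2)

/-- Batch random feature estimate: the parameter vector after the measurements at times
`1, …, t`. -/
def rfTheta {D : Finset Plane} {n p : ℕ} (v : Fin p → Plane) (s σ : ℝ)
    (z : ℕ → Option (Fin n) → D) (y : ℕ → Option (Fin n) → ℝ) (t : ℕ) : FeatIdx p → ℝ :=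
  ((featureMatrix v z t)ᵀ * featureMatrix v z t + (σ ^ 2 / s ^ 2) • 1)⁻¹ *ᵥ
    ((featureMatrix v z t)ᵀ *ᵥ fun a => y (a.1 + 1) a.2)

/-- Batch random feature estimate: the parameter covariance. -/
def rfSigma {D : Finset Plane} {n p : ℕ} (v : Fin p → Plane) (s σ : ℝ)
    (z : ℕ → Option (Fin n) → D) (t : ℕ) : Matrix (FeatIdx p) (FeatIdx p) ℝ :=
  ((1 / σ ^ 2) • ((featureMatrix v z t)ᵀ * featureMatrix v z t) + (1 / s ^ 2) • 1)⁻¹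

/-- The matrix whose columns are the features of the `n + 1` locations sampled at time `t`. -/
def stepFeatures {D : Finset Plane} {n p : ℕ} (v : Fin p → Plane) (z : ℕ → Option (Fin n) → D)
    (t : ℕ) : Matrix (FeatIdx p) (Option (Fin n)) ℝ :=
  Matrix.of fun c o => feature v (z t o) c

/-- Online random feature estimate: parameter vector and parameter covariance after time `t`.
At each time the covariance of the `n + 1` new measurements is predicted (`S`, which includes the
measurement noise), and the parameters are corrected by the prediction error. -/
def onlineState {D : Finset Plane} {n p : ℕ} (v : Fin p → Plane) (s σ : ℝ) (θ₀ : FeatIdx p → ℝ)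
    (z : ℕ → Option (Fin n) → D) (y : ℕ → Option (Fin n) → ℝ) :
    ℕ → (FeatIdx p → ℝ) × Matrix (FeatIdx p) (FeatIdx p) ℝ
  | 0 => (θ₀, s ^ 2 • 1)
  | t + 1 =>
    let θ := (onlineState v s σ θ₀ z y t).1
    let Sig := (onlineState v s σ θ₀ z y t).2
    let Φ := stepFeatures v z (t + 1)
    let S := Φᵀ * Sig * Φ + σ ^ 2 • (1 : Matrix (Option (Fin n)) (Option (Fin n)) ℝ)
    (θ + (Sig * Φ * S⁻¹) *ᵥ (y (t + 1) - Φᵀ *ᵥ θ), Sig - Sig * Φ * S⁻¹ * Φᵀ * Sig)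

/-- The three ways to run the estimation step: exact Gaussian process regression, its batch random
feature version with `p` frequencies `v` and magnitude `s ^ 2`, and the online random feature
version with initial parameter `θ₀`. -/
inductive Estimator : Type
  | gp : Estimator
  | rfgp (p : ℕ) (v : Fin p → Plane) (s : ℝ) : Estimator
  | orfgp (p : ℕ) (v : Fin p → Plane) (s : ℝ) (θ₀ : FeatIdx p → ℝ) : Estimator

/-- The estimator is based on the prior with mean `m` and kernel `k`. No condition for exact
regression (which takes `m` and `k` as its inputs); the random feature versions are based on the
prior of `⟨feature v ·, θ⟩` with `θ ∼ N(θ₀, s ^ 2 I)` (`θ₀ = 0` for the batch version). -/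
def Estimator.HasPrior {D : Finset Plane} (m : D → ℝ) (k : D → D → ℝ) : Estimator → Prop
  | .gp => True
  | .rfgp _ v s => 0 < s ∧ (∀ q, m q = 0) ∧
      ∀ q q' : D, k q q' = s ^ 2 * (feature v q ⬝ᵥ feature v q')
  | .orfgp _ v s θ₀ => 0 < s ∧ (∀ q : D, m q = feature v q ⬝ᵥ θ₀) ∧
      ∀ q q' : D, k q q' = s ^ 2 * (feature v q ⬝ᵥ feature v q')

/-- The estimated mean `μ_t` after the measurements at times `1, …, t`. -/
def Estimator.mean {D : Finset Plane} {n : ℕ} (m : D → ℝ) (k : D → D → ℝ) (σ : ℝ)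
    (z : ℕ → Option (Fin n) → D) (y : ℕ → Option (Fin n) → ℝ) (t : ℕ) (q : D) : Estimator → ℝ
  | .gp => gpMean m k σ z y t q
  | .rfgp _ v s => feature v q ⬝ᵥ rfTheta v s σ z y t
  | .orfgp _ v s θ₀ => feature v q ⬝ᵥ (onlineState v s σ θ₀ z y t).1

/-- The estimated standard deviation `σ_t` after the measurements at times `1, …, t`. -/
def Estimator.sd {D : Finset Plane} {n : ℕ} (k : D → D → ℝ) (σ : ℝ)
    (z : ℕ → Option (Fin n) → D) (y : ℕ → Option (Fin n) → ℝ) (t : ℕ) (q : D) : Estimator → ℝ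
  | .gp => √(gpVar k σ z t q)
  | .rfgp _ v s => √(feature v q ⬝ᵥ (rfSigma v s σ z t *ᵥ feature v q))
  | .orfgp _ v s θ₀ => √(feature v q ⬝ᵥ ((onlineState v s σ θ₀ z y t).2 *ᵥ feature v q))

/-! ### The random model and the algorithm -/

/-- `F` is a Gaussian process on the finite domain `D` with mean `m` and covariance function
`k`. -/
structure IsGP {Ω : Type*} [MeasurableSpace Ω] (P : Measure Ω) {D : Finset Plane}
    (m : D → ℝ) (k : D → D → ℝ) (F : D → Ω → ℝ) : Prop where
  measurable : ∀ q, Measurable (F q)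
  gaussian : IsGaussianProcess F P
  mean_eq : ∀ q, ∫ ω, F q ω ∂P = m q
  cov_eq : ∀ q q', covariance (F q) (F q') P = k q q'

/-- The measurement noises are i.i.d. `N(0, σ ^ 2)`, the noises are independent of the field `F`,
and the initial positions `x₀` are independent of the field and the noises. -/
structure IsNoise {Ω : Type*} [MeasurableSpace Ω] (P : Measure Ω) {D : Finset Plane} {n : ℕ}
    (σ : ℝ) (F : D → Ω → ℝ) (x₀ : Ω → Fin n → D) (ε : ℕ → Option (Fin n) → Ω → ℝ) : Prop where
  measurable : ∀ t o, Measurable (ε t o)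
  measurable_init : Measurable x₀
  law : ∀ t o, P.map (ε t o) = gaussianReal 0 (Real.toNNReal (σ ^ 2))
  iIndep : iIndepFun (fun a : ℕ × Option (Fin n) => ε a.1 a.2) P
  indep_field : IndepFun (fun ω q => F q ω) (fun ω (a : ℕ × Option (Fin n)) => ε a.1 a.2 ω) P
  indep_init : IndepFun x₀
    (fun ω => ((fun q => F q ω), fun a : ℕ × Option (Fin n) => ε a.1 a.2 ω)) P

/-- The sampled locations: `some i` is the position of robot `i`, `none` the additional one. -/
def sites {D : Finset Plane} {n : ℕ} (x : ℕ → Fin n → D) (xt : ℕ → D) :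
    ℕ → Option (Fin n) → D
  | t, some i => x t i
  | t, none => xt t

/-- The measurements: the value of the field at the sampled locations plus noise. -/
def measurement {Ω : Type*} {D : Finset Plane} {n : ℕ} (F : D → Ω → ℝ)
    (ε : ℕ → Option (Fin n) → Ω → ℝ) (x : ℕ → Ω → Fin n → D) (xt : ℕ → Ω → D)
    (t : ℕ) (o : Option (Fin n)) (ω : Ω) : ℝ :=
  F (sites (fun s => x s ω) (fun s => xt s ω) t o) ω + ε t o ω

/-- The information available when the locations of time `t` are chosen: the initial positions
and the measurements at times `1, …, t - 1`. -/
abbrev history {Ω : Type*} {D : Finset Plane} {n : ℕ} (x₀ : Ω → Fin n → D)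
    (Y : ℕ → Option (Fin n) → Ω → ℝ) (t : ℕ) : MeasurableSpace Ω :=
  MeasurableSpace.comap x₀ inferInstance ⊔
    ⨆ s ∈ Set.Ico 1 t, ⨆ o, MeasurableSpace.comap (Y s o) inferInstance

/-- The sequence `β_t = 2 log (|D| t² π² / (6 δ))`. -/
def beta (D : Finset Plane) (δ : ℝ) (t : ℕ) : ℝ :=
  2 * Real.log ((D.card : ℝ) * ((t : ℝ) ^ 2 * Real.pi ^ 2 / (6 * δ)))

/-- The positions `x` and the additional sampling locations `xt` are produced by the algorithm,
with a control law that reaches a global minimizer of the cost for the current surrogate. Ties may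
be broken in any way that uses only the available information. -/
structure IsRun {Ω : Type*} {D : Finset Plane} {n : ℕ} (E : Estimator)
    (m : D → ℝ) (k : D → D → ℝ) (σ δ : ℝ) (F : D → Ω → ℝ) (ε : ℕ → Option (Fin n) → Ω → ℝ)
    (x : ℕ → Ω → Fin n → D) (xt : ℕ → Ω → D) : Prop where
  control : ∀ t, 1 ≤ t → ∀ ω,
    let z := sites (fun s => x s ω) (fun s => xt s ω)
    let y := fun s o => measurement F ε x xt s o ω
    ∀ x' : Fin n → D,
      cost (fun q => E.mean m k σ z y (t - 1) q - √(beta D δ t) * E.sd k σ z y (t - 1) q) (x t ω) ≤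
        cost (fun q => E.mean m k σ z y (t - 1) q - √(beta D δ t) * E.sd k σ z y (t - 1) q) x'
  sample : ∀ t, 1 ≤ t → ∀ ω,
    let z := sites (fun s => x s ω) (fun s => xt s ω)
    let y := fun s o => measurement F ε x xt s o ω
    ∀ q, E.sd k σ z y (t - 1) q ≤ E.sd k σ z y (t - 1) (xt t ω)
  adapted_control : ∀ t, 1 ≤ t → Measurable[history (x 0) (measurement F ε x xt) t] (x t)
  adapted_sample : ∀ t, 1 ≤ t → Measurable[history (x 0) (measurement F ε x xt) t] (xt t)

/-! ### Information gain -/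

/-- Mutual information of a pair of random variables with joint law `ρ`. -/
def mutualInfo {α β : Type*} [MeasurableSpace α] [MeasurableSpace β] (ρ : Measure (α × β)) :
    ENNReal :=
  InformationTheory.klDiv ρ (ρ.fst.prod ρ.snd)

/-- The joint law of `f_A = (f (a j))_j` and `y_A = f_A + noise`, where the field `f` has law `ν`
and the noise is independent of it with i.i.d. `N(0, σ ^ 2)` entries. -/
def sampleLaw {D : Finset Plane} (ν : Measure (D → ℝ)) (σ : ℝ) {T : ℕ} (a : Fin T → D) :
    Measure ((Fin T → ℝ) × (Fin T → ℝ)) :=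
  (ν.prod (Measure.pi fun _ : Fin T => gaussianReal 0 (Real.toNNReal (σ ^ 2)))).map
    fun w => ((fun j => w.1 (a j)), fun j => w.1 (a j) + w.2 j)

/-- The maximum information gain `γ_T` about a field of law `ν` from `T` noisy samples (locations
may be sampled repeatedly). -/
def maxInfoGain {D : Finset Plane} (ν : Measure (D → ℝ)) (σ : ℝ) (T : ℕ) : ℝ :=
  ⨆ a : Fin T → D, (mutualInfo (sampleLaw ν σ a)).toReal

/-- The constant `c₁ = 8 |D|² max ‖x - x'‖⁴ / log (1 + σ⁻²)`. -/
def constOne (D : Finset Plane) (σ : ℝ) : ℝ :=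
  8 * (D.card : ℝ) ^ 2 *
    ⨆ w : D × D, ‖(w.1 : Plane) - w.2‖ ^ 4 / Real.log (1 + (σ ^ 2)⁻¹)

end

end ORC

/-! Everything rests on one event, `IsCalibrated`: for all times `t` and points `q`, the field lies
within `√β_{t+1} σ_t(q)` of the posterior mean. By Woodbury's identity and induction over time, the
three estimators compute the same posterior, so only exact Gaussian process regression is analysed.

For fixed locations, the error of the best linear predictor is Gaussian, has the posterior variance
as its variance and is independent of the samples. Adaptive locations are handled by splitting over
the finitely many possible trajectories `ζ`: the event of following `ζ` is determined by the initial
positions and the samples along `ζ`, which are independent of the error for `ζ`, so the Gaussian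
tail bound survives (`measure_lt_abs_sub_gpMean_le`). A union bound over points and times, summed by
the Basel series, costs `δ`.

On this event the surrogate lies below `f` by at most `2 √β σ`. Its minimizer thus has regret at
most a constant times `√β_t` times the largest posterior deviation, attained at the additional
sampling location. By Cauchy–Schwarz it remains to sum the posterior variances there. They only grow
if the robots' own samples are forgotten; Bernoulli's inequality bounds them by logarithms whose sum
is a log-determinant (`det_noisyGram`), that is, twice an information gain
(`toReal_mutualInfo_sampleLaw`).

The limit has a separate source. On a finite domain, greedy sampling revisits some point about `t /
|D|` times, which forces the maximal variance down to order `1 / t` (`gpVar_le_of_greedy`), while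
`β_t` grows logarithmically. The regret of single steps tends to zero, and so do its Cesàro means.
-/

namespace ORC

noncomputable section

set_option linter.unusedSectionVars false

/-! ### Best linear prediction from noisy samples. -/

section Kriging

variable {α ι κ : Type*} [Fintype ι] [Fintype κ] [DecidableEq ι] [DecidableEq κ]

/-- The covariance matrix of noisy samples at the locations `z`. -/
def noisyGram (k : α → α → ℝ) (σ : ℝ) (z : ι → α) : Matrix ι ι ℝ :=
  Matrix.of (fun i j => k (z i) (z j)) + σ ^ 2 • 1

/-- The covariances between the value at `q` and the values at the locations `z`. -/
def crossCov (k : α → α → ℝ) (z : ι → α) (q : α) : ι → ℝ := fun i => k (z i) q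

/-- The weights of the best linear predictor of the value at `q` from noisy samples. -/
def krigWeights (k : α → α → ℝ) (σ : ℝ) (z : ι → α) (q : α) : ι → ℝ :=
  (noisyGram k σ z)⁻¹ *ᵥ crossCov k z q

/-- The posterior variance at `q` given noisy samples at the locations `z`. -/
def krigVar (k : α → α → ℝ) (σ : ℝ) (z : ι → α) (q : α) : ℝ :=
  k q q - crossCov k z q ⬝ᵥ krigWeights k σ z q

/-- The mean squared error of the linear predictor with weights `a`. -/
def predMSE (k : α → α → ℝ) (σ : ℝ) (z : ι → α) (q : α) (a : ι → ℝ) : ℝ :=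
  k q q - 2 * (a ⬝ᵥ crossCov k z q) + a ⬝ᵥ (noisyGram k σ z *ᵥ a)

variable {k : α → α → ℝ} {σ : ℝ}

-- The kernel matrix may be singular, for instance when locations repeat; the noise term makes the
-- inverse in the predictor genuine.
omit [Fintype ι] in
lemma posDef_noisyGram (hk : (Matrix.of k).PosSemidef) (hσ : 0 < σ) (z : ι → α) :
    (noisyGram k σ z).PosDef := by
  refine Matrix.PosDef.posSemidef_add (hk.submatrix z) ?_
  exact Matrix.PosDef.one.smul (by positivity)

lemma noisyGram_mulVec_krigWeights (hk : (Matrix.of k).PosSemidef) (hσ : 0 < σ) (z : ι → α)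
    (q : α) : noisyGram k σ z *ᵥ krigWeights k σ z q = crossCov k z q := by
  have h := (posDef_noisyGram hk hσ z).isUnit
  rw [krigWeights, Matrix.mulVec_mulVec, Matrix.mul_nonsing_inv _
    ((Matrix.isUnit_iff_isUnit_det _).1 h), Matrix.one_mulVec]

lemma dotProduct_noisyGram_comm (hk : (Matrix.of k).PosSemidef) (hσ : 0 < σ) (z : ι → α)
    (a b : ι → ℝ) : a ⬝ᵥ (noisyGram k σ z *ᵥ b) = b ⬝ᵥ (noisyGram k σ z *ᵥ a) := by
  have h : (noisyGram k σ z)ᵀ = noisyGram k σ z := by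
    simpa using (posDef_noisyGram hk hσ z).isHermitian.eq
  rw [Matrix.dotProduct_mulVec, ← Matrix.mulVec_transpose, h, dotProduct_comm]

lemma predMSE_krigWeights (hk : (Matrix.of k).PosSemidef) (hσ : 0 < σ) (z : ι → α) (q : α) :
    predMSE k σ z q (krigWeights k σ z q) = krigVar k σ z q := by
  rw [predMSE, noisyGram_mulVec_krigWeights hk hσ, krigVar,
    dotProduct_comm (krigWeights k σ z q)]
  ring

/-- Completing the square: the excess error is the quadratic form of the noisy Gram matrix at the
difference of the weights. Upper bounds on the posterior variance then follow by testing with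
convenient weights. -/
lemma krigVar_le_predMSE (hk : (Matrix.of k).PosSemidef) (hσ : 0 < σ) (z : ι → α) (q : α)
    (a : ι → ℝ) : krigVar k σ z q ≤ predMSE k σ z q a := by
  set w := krigWeights k σ z q with hw
  have h0 : 0 ≤ (a - w) ⬝ᵥ (noisyGram k σ z *ᵥ (a - w)) := by
    simpa using (posDef_noisyGram hk hσ z).posSemidef.dotProduct_mulVec_nonneg (a - w)
  have h1 : noisyGram k σ z *ᵥ w = crossCov k z q := noisyGram_mulVec_krigWeights hk hσ z q
  have h2 : w ⬝ᵥ (noisyGram k σ z *ᵥ a) = a ⬝ᵥ crossCov k z q := by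
    rw [dotProduct_noisyGram_comm hk hσ, h1]
  rw [Matrix.mulVec_sub, sub_dotProduct, dotProduct_sub, dotProduct_sub, h1, h2] at h0
  rw [krigVar, predMSE, ← hw, dotProduct_comm (crossCov k z q)]
  linarith

/-- More samples do not increase the posterior variance. -/
lemma krigVar_le_comp (hk : (Matrix.of k).PosSemidef) (hσ : 0 < σ) (z : κ → α) (e : ι → κ)
    (he : Function.Injective e) (q : α) : krigVar k σ z q ≤ krigVar k σ (z ∘ e) q := by
  set w := krigWeights k σ (z ∘ e) q with hw
  -- `X` selects the samples in the image of `e`, so `Xᵀ *ᵥ w` extends the weights `w` by zero to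
  -- all samples.
  set X : Matrix ι κ ℝ := (1 : Matrix κ κ ℝ).submatrix e id with hX
  have hXv : ∀ u : κ → ℝ, X *ᵥ u = u ∘ e := fun u => by
    ext i; simp [hX, Matrix.mulVec, dotProduct, Matrix.one_apply]
  have hXX : X * noisyGram k σ z * Xᵀ = noisyGram k σ (z ∘ e) := by
    have : X * noisyGram k σ z * Xᵀ = (noisyGram k σ z).submatrix e e := by
      ext i j
      simp [hX, Matrix.mul_apply, Matrix.one_apply]
    rw [this]
    ext i j
    simp [noisyGram, Matrix.one_apply, he.eq_iff]
  rw [← predMSE_krigWeights hk hσ (z ∘ e), ← hw]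
  refine (krigVar_le_predMSE hk hσ z q (Xᵀ *ᵥ w)).trans_eq ?_
  have h1 : (Xᵀ *ᵥ w) ⬝ᵥ crossCov k z q = w ⬝ᵥ crossCov k (z ∘ e) q := by
    rw [Matrix.mulVec_transpose, ← Matrix.dotProduct_mulVec, hXv]; rfl
  have h2 : (Xᵀ *ᵥ w) ⬝ᵥ (noisyGram k σ z *ᵥ (Xᵀ *ᵥ w)) =
      w ⬝ᵥ (noisyGram k σ (z ∘ e) *ᵥ w) := by
    rw [← hXX, Matrix.mulVec_transpose, ← Matrix.dotProduct_mulVec, ← Matrix.mulVec_transpose,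
      Matrix.mulVec_mulVec, Matrix.mulVec_mulVec, Matrix.mul_assoc]
  rw [predMSE, predMSE, h1, h2]

lemma krigVar_le_prior (hk : (Matrix.of k).PosSemidef) (hσ : 0 < σ) (z : ι → α) (q : α) :
    krigVar k σ z q ≤ k q q := by
  simpa [predMSE] using krigVar_le_predMSE hk hσ z q 0

/-- The posterior variance at a location sampled `N` times. -/
lemma krigVar_le_div_of_repeated (hk : (Matrix.of k).PosSemidef) (hσ : 0 < σ) (z : κ → α)
    (q : α) {N : ℕ} (hN : 0 < N) (e : Fin N → κ) (he : Function.Injective e)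
    (hz : ∀ j, z (e j) = q) : krigVar k σ z q ≤ σ ^ 2 / N := by
  -- Only the `N` samples at `q` are kept, and they are averaged: the signal terms cancel and
  -- averaging the noises leaves `σ ^ 2 / N`.
  refine (krigVar_le_comp hk hσ z e he q).trans
    ((krigVar_le_predMSE hk hσ _ q fun _ => (N : ℝ)⁻¹).trans_eq ?_)
  have hN' : (N : ℝ) ≠ 0 := by positivity
  have h1 : crossCov k (z ∘ e) q = fun _ => k q q := by ext j; simp [crossCov, hz]
  have h2 : noisyGram k σ (z ∘ e) *ᵥ (fun _ => (N : ℝ)⁻¹) =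
      fun _ => k q q + σ ^ 2 * (N : ℝ)⁻¹ := by
    ext j
    simp [noisyGram, Matrix.mulVec, dotProduct, hz, add_mul, Finset.sum_add_distrib,
      Matrix.one_apply]
    field_simp
  rw [predMSE, h1, h2]
  simp [dotProduct]
  field_simp
  ring

end Kriging

/-- Adding one sample multiplies the determinant of the covariance matrix of the noisy samples by
the predictive variance. -/
lemma det_noisyGram_succ {α : Type*} {k : α → α → ℝ} {σ : ℝ} (hk : (Matrix.of k).PosSemidef)
    (hσ : 0 < σ) {T : ℕ} (z : Fin (T + 1) → α) :
    (noisyGram k σ z).det = (noisyGram k σ fun i : Fin T => z i.castSucc).det *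
      (σ ^ 2 + krigVar k σ (fun i : Fin T => z i.castSucc) (z (Fin.last T))) := by
  set z' : Fin T → α := fun i => z i.castSucc with hz'
  have hsym : ∀ a b, k a b = k b a := fun a b => by
    simpa using hk.isHermitian.apply b a
  have hU := (posDef_noisyGram hk hσ z').isUnit
  let _ : Invertible (noisyGram k σ z') := hU.invertible
  -- With the last sample split off, the Schur complement is the scalar predictive variance.
  have hblocks : (noisyGram k σ z).submatrix (finSumFinEquiv (m := T) (n := 1))
      (finSumFinEquiv (m := T) (n := 1)) = Matrix.fromBlocks (noisyGram k σ z')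
        (Matrix.of fun i _ => k (z' i) (z (Fin.last T)))
        (Matrix.of fun _ j => k (z' j) (z (Fin.last T)))
        (Matrix.of fun _ _ => k (z (Fin.last T)) (z (Fin.last T)) + σ ^ 2) := by
    have hl : ∀ i : Fin 1, Fin.natAdd T i = Fin.last T := fun i => by
      ext; simp
    have hc : ∀ i : Fin T, Fin.castAdd 1 i = i.castSucc := fun i => rfl
    ext (i | i) (j | j)
    · simp [noisyGram, Matrix.one_apply, hz', hc]
    · simp [noisyGram, hz', hc, hl, (Fin.castSucc_lt_last i).ne]
    · simp [noisyGram, hz', hc, hl, (Fin.castSucc_lt_last j).ne', hsym]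
    · simp [noisyGram, hl]
  rw [← Matrix.det_submatrix_equiv_self (finSumFinEquiv (m := T) (n := 1)), hblocks,
    Matrix.det_fromBlocks₁₁]
  congr 1
  rw [Matrix.det_fin_one, Matrix.invOf_eq_nonsing_inv, Matrix.sub_apply]
  simp only [krigVar, krigWeights]
  have : ((Matrix.of fun (_ : Fin 1) j => k (z' j) (z (Fin.last T))) * (noisyGram k σ z')⁻¹ *
      (Matrix.of fun i (_ : Fin 1) => k (z' i) (z (Fin.last T)))) 0 0 =
      crossCov k z' (z (Fin.last T)) ⬝ᵥ
        ((noisyGram k σ z')⁻¹ *ᵥ crossCov k z' (z (Fin.last T))) := by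
    rw [Matrix.mul_assoc]
    rfl
  rw [this, Matrix.of_apply]
  ring

/-- After taking logarithms this is the chain rule for the information gain. -/
lemma det_noisyGram {α : Type*} {k : α → α → ℝ} {σ : ℝ} (hk : (Matrix.of k).PosSemidef)
    (hσ : 0 < σ) {T : ℕ} (z : ℕ → α) :
    (noisyGram k σ fun i : Fin T => z i).det =
      ∏ j ∈ Finset.range T, (σ ^ 2 + krigVar k σ (fun i : Fin j => z i) (z j)) := by
  induction T with
  | zero => simp
  | succ T ih =>
    rw [Finset.prod_range_succ, ← ih, det_noisyGram_succ hk hσ]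
    rfl

/-! ### Matrix identities for Gaussian updates. -/

section Woodbury

variable {ι c : Type*} [Fintype ι] [Fintype c] [DecidableEq ι] [DecidableEq c]

/-- The Woodbury identity for a posterior covariance. -/
lemma inv_add_smul_mul_transpose {B : Matrix c c ℝ} (hB : B.PosDef) (Ψ : Matrix c ι ℝ) {σ : ℝ}
    (hσ : 0 < σ) :
    (B + (1 / σ ^ 2) • (Ψ * Ψᵀ))⁻¹ =
      B⁻¹ - B⁻¹ * Ψ * (Ψᵀ * B⁻¹ * Ψ + σ ^ 2 • (1 : Matrix ι ι ℝ))⁻¹ * Ψᵀ * B⁻¹ := by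
  have hS : (Ψᵀ * B⁻¹ * Ψ + σ ^ 2 • (1 : Matrix ι ι ℝ)).PosDef :=
    Matrix.PosDef.posSemidef_add (by simpa using hB.inv.posSemidef.conjTranspose_mul_mul_same Ψ)
      (Matrix.PosDef.one.smul (by positivity))
  set S := Ψᵀ * B⁻¹ * Ψ + σ ^ 2 • (1 : Matrix ι ι ℝ) with hSdef
  have hBi : B * B⁻¹ = 1 := Matrix.mul_nonsing_inv _ ((Matrix.isUnit_iff_isUnit_det _).1 hB.isUnit)
  have hSi : S * S⁻¹ = 1 := Matrix.mul_nonsing_inv _ ((Matrix.isUnit_iff_isUnit_det _).1 hS.isUnit)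
  refine Matrix.inv_eq_right_inv ?_
  have h1 : Ψᵀ * B⁻¹ * Ψ = S - σ ^ 2 • (1 : Matrix ι ι ℝ) := by rw [hSdef]; abel
  have h2 : Ψ * Ψᵀ * (B⁻¹ * Ψ * S⁻¹ * Ψᵀ * B⁻¹) =
      Ψ * Ψᵀ * B⁻¹ - σ ^ 2 • (Ψ * S⁻¹ * Ψᵀ * B⁻¹) := by
    calc _ = Ψ * (Ψᵀ * B⁻¹ * Ψ) * S⁻¹ * Ψᵀ * B⁻¹ := by simp only [Matrix.mul_assoc]
      _ = Ψ * (S * S⁻¹) * Ψᵀ * B⁻¹ - σ ^ 2 • (Ψ * S⁻¹ * Ψᵀ * B⁻¹) := by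
        rw [h1]; simp only [Matrix.mul_sub, Matrix.sub_mul, Matrix.mul_assoc, Matrix.mul_smul,
          Matrix.smul_mul, Matrix.mul_one]
      _ = _ := by rw [hSi, Matrix.mul_one]
  have h3 : B * (B⁻¹ * Ψ * S⁻¹ * Ψᵀ * B⁻¹) = Ψ * S⁻¹ * Ψᵀ * B⁻¹ := by
    simp only [← Matrix.mul_assoc, hBi, Matrix.one_mul]
  rw [Matrix.add_mul, Matrix.mul_sub, hBi, h3, Matrix.smul_mul, Matrix.mul_sub, h2, sub_sub_cancel,
    smul_smul, one_div, inv_mul_cancel₀ (by positivity), one_smul]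
  abel

/-- The two forms of the gain matrix. -/
lemma mul_inv_eq_smul_inv_mul {B : Matrix c c ℝ} (hB : B.PosDef) (Ψ : Matrix c ι ℝ) {σ : ℝ}
    (hσ : 0 < σ) :
    B⁻¹ * Ψ * (Ψᵀ * B⁻¹ * Ψ + σ ^ 2 • (1 : Matrix ι ι ℝ))⁻¹ =
      (1 / σ ^ 2) • ((B + (1 / σ ^ 2) • (Ψ * Ψᵀ))⁻¹ * Ψ) := by
  have hS : (Ψᵀ * B⁻¹ * Ψ + σ ^ 2 • (1 : Matrix ι ι ℝ)).PosDef :=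
    Matrix.PosDef.posSemidef_add (by simpa using hB.inv.posSemidef.conjTranspose_mul_mul_same Ψ)
      (Matrix.PosDef.one.smul (by positivity))
  have hB' : (B + (1 / σ ^ 2) • (Ψ * Ψᵀ)).PosDef :=
    hB.add_posSemidef ((by simpa using Matrix.posSemidef_self_mul_conjTranspose Ψ :
      (Ψ * Ψᵀ).PosSemidef).smul (by positivity))
  set S := Ψᵀ * B⁻¹ * Ψ + σ ^ 2 • (1 : Matrix ι ι ℝ) with hSdef
  set B' := B + (1 / σ ^ 2) • (Ψ * Ψᵀ) with hBdef
  have hBi : B * B⁻¹ = 1 := Matrix.mul_nonsing_inv _ ((Matrix.isUnit_iff_isUnit_det _).1 hB.isUnit)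
  have hBi' : B'⁻¹ * B' = 1 :=
    Matrix.nonsing_inv_mul _ ((Matrix.isUnit_iff_isUnit_det _).1 hB'.isUnit)
  have hSi : S * S⁻¹ = 1 := Matrix.mul_nonsing_inv _ ((Matrix.isUnit_iff_isUnit_det _).1 hS.isUnit)
  have hσ2 : σ ^ 2 ≠ 0 := by positivity
  -- The push-through identity; multiplying by `B'⁻¹` on the left and `S⁻¹` on the right gives the
  -- claim.
  have h : B' * (B⁻¹ * Ψ) = (1 / σ ^ 2) • (Ψ * S) := by
    rw [hBdef, hSdef, Matrix.add_mul, ← Matrix.mul_assoc, hBi, Matrix.one_mul, Matrix.mul_add,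
      smul_add, Matrix.mul_smul, smul_smul, one_div, inv_mul_cancel₀ hσ2, one_smul, Matrix.mul_one,
      add_comm, Matrix.smul_mul]
    simp only [Matrix.mul_assoc]
  calc B⁻¹ * Ψ * S⁻¹ = B'⁻¹ * (B' * (B⁻¹ * Ψ)) * S⁻¹ := by
        rw [← Matrix.mul_assoc B'⁻¹, hBi', Matrix.one_mul]
    _ = (1 / σ ^ 2) • (B'⁻¹ * Ψ * (S * S⁻¹)) := by
        rw [h]; simp only [Matrix.mul_assoc, Matrix.mul_smul, Matrix.smul_mul]
    _ = _ := by rw [hSi, Matrix.mul_one]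

end Woodbury

/-! ### Agreement of the three estimators. -/

section Estimators

variable {D : Finset Plane} {n p : ℕ}

/-- The locations sampled at times `1, …, t`, indexed by the measurements. -/
def sampled (z : ℕ → Option (Fin n) → D) (t : ℕ) : DataIdx n t → D := fun a => z (a.1 + 1) a.2

lemma gpVar_eq_krigVar (k : D → D → ℝ) (σ : ℝ) (z : ℕ → Option (Fin n) → D) (t : ℕ) (q : D) :
    gpVar k σ z t q = krigVar k σ (sampled z t) q := rfl

/-- Symmetry of the inverse moves it from the residuals to the kernel vector, exhibiting the
posterior mean as a linear predictor with the kriging weights. -/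
lemma gpMean_eq (k : D → D → ℝ) (hk : (Matrix.of k).PosSemidef) {σ : ℝ} (hσ : 0 < σ) (m : D → ℝ)
    (z : ℕ → Option (Fin n) → D) (y : ℕ → Option (Fin n) → ℝ) (t : ℕ) (q : D) :
    gpMean m k σ z y t q =
      m q + krigWeights k σ (sampled z t) q ⬝ᵥ
        fun a => y (a.1 + 1) a.2 - m (sampled z t a) := by
  have h : ((noisyGram k σ (sampled z t))⁻¹)ᵀ = (noisyGram k σ (sampled z t))⁻¹ := by
    simpa using (posDef_noisyGram hk hσ (sampled z t)).inv.isHermitian.eq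
  rw [krigWeights, ← h, Matrix.mulVec_transpose, ← Matrix.dotProduct_mulVec]
  rfl

lemma posDef_rfPrecision (v : Fin p → Plane) {s σ : ℝ} (hs : 0 < s)
    (z : ℕ → Option (Fin n) → D) (t : ℕ) :
    ((1 / σ ^ 2) • ((featureMatrix v z t)ᵀ * featureMatrix v z t) +
      (1 / s ^ 2) • (1 : Matrix (FeatIdx p) (FeatIdx p) ℝ)).PosDef :=
  Matrix.PosDef.posSemidef_add
    ((by simpa using Matrix.posSemidef_conjTranspose_mul_self (featureMatrix v z t) :
      ((featureMatrix v z t)ᵀ * featureMatrix v z t).PosSemidef).smul (by positivity))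
    (Matrix.PosDef.one.smul (by positivity))

section

variable {k : D → D → ℝ} {v : Fin p → Plane} {s σ : ℝ}

lemma noisyGram_sampled (hk : ∀ q q' : D, k q q' = s ^ 2 * (feature v q ⬝ᵥ feature v q'))
    (z : ℕ → Option (Fin n) → D) (t : ℕ) :
    noisyGram k σ (sampled z t) =
      s ^ 2 • (featureMatrix v z t * (featureMatrix v z t)ᵀ) + σ ^ 2 • 1 := by
  ext a b
  simp [noisyGram, hk, sampled, featureMatrix, Matrix.mul_apply, dotProduct]

lemma crossCov_sampled (hk : ∀ q q' : D, k q q' = s ^ 2 * (feature v q ⬝ᵥ feature v q'))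
    (z : ℕ → Option (Fin n) → D) (t : ℕ) (q : D) :
    crossCov k (sampled z t) q = s ^ 2 • (featureMatrix v z t *ᵥ feature v q) := by
  ext a
  simp [crossCov, hk, sampled, featureMatrix, Matrix.mulVec]

/-- Woodbury for the prior precision `s⁻² I` trades an inverse in feature space for one in sample
space, where the kernel matrix appears. -/
lemma rfSigma_eq (hs : 0 < s) (hσ : 0 < σ)
    (hk : ∀ q q' : D, k q q' = s ^ 2 * (feature v q ⬝ᵥ feature v q'))
    (z : ℕ → Option (Fin n) → D) (t : ℕ) :
    rfSigma v s σ z t = s ^ 2 • 1 - (s ^ 2 • (featureMatrix v z t)ᵀ) *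
      (noisyGram k σ (sampled z t))⁻¹ * (s ^ 2 • featureMatrix v z t) := by
  have hs2 : s ^ 2 ≠ 0 := by positivity
  have h := inv_add_smul_mul_transpose (B := (1 / s ^ 2) • (1 : Matrix (FeatIdx p) (FeatIdx p) ℝ))
    (Matrix.PosDef.one.smul (by positivity)) (featureMatrix v z t)ᵀ hσ
  have hi : ((1 / s ^ 2) • (1 : Matrix (FeatIdx p) (FeatIdx p) ℝ))⁻¹ = s ^ 2 • 1 := by
    refine Matrix.inv_eq_right_inv ?_
    rw [Matrix.smul_mul, Matrix.one_mul, smul_smul, one_div, inv_mul_cancel₀ hs2, one_smul]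
  rw [hi, Matrix.transpose_transpose] at h
  rw [rfSigma, add_comm, h, noisyGram_sampled hk]
  simp only [Matrix.mul_smul, Matrix.smul_mul, Matrix.mul_one, Matrix.one_mul]

lemma rfSigma_mul_transpose (hs : 0 < s) (hσ : 0 < σ)
    (hk : ∀ q q' : D, k q q' = s ^ 2 * (feature v q ⬝ᵥ feature v q'))
    (z : ℕ → Option (Fin n) → D) (t : ℕ) :
    (1 / σ ^ 2) • (rfSigma v s σ z t * (featureMatrix v z t)ᵀ) =
      s ^ 2 • ((featureMatrix v z t)ᵀ * (noisyGram k σ (sampled z t))⁻¹) := by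
  have hs2 : s ^ 2 ≠ 0 := by positivity
  have h := mul_inv_eq_smul_inv_mul (B := (1 / s ^ 2) • (1 : Matrix (FeatIdx p) (FeatIdx p) ℝ))
    (Matrix.PosDef.one.smul (by positivity)) (featureMatrix v z t)ᵀ hσ
  have hi : ((1 / s ^ 2) • (1 : Matrix (FeatIdx p) (FeatIdx p) ℝ))⁻¹ = s ^ 2 • 1 := by
    refine Matrix.inv_eq_right_inv ?_
    rw [Matrix.smul_mul, Matrix.one_mul, smul_smul, one_div, inv_mul_cancel₀ hs2, one_smul]
  rw [hi, Matrix.transpose_transpose] at h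
  rw [rfSigma, add_comm, ← h, noisyGram_sampled hk]
  simp only [Matrix.mul_smul, Matrix.smul_mul, Matrix.one_mul, Matrix.mul_one]

/-- The random feature posterior variance is the Gaussian process posterior variance. -/
lemma feature_dotProduct_rfSigma (hs : 0 < s) (hσ : 0 < σ)
    (hk : ∀ q q' : D, k q q' = s ^ 2 * (feature v q ⬝ᵥ feature v q'))
    (z : ℕ → Option (Fin n) → D) (t : ℕ) (q : D) :
    feature v q ⬝ᵥ (rfSigma v s σ z t *ᵥ feature v q) = gpVar k σ z t q := by
  rw [gpVar_eq_krigVar, krigVar, krigWeights, crossCov_sampled hk, rfSigma_eq hs hσ hk, hk]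
  simp only [Matrix.sub_mulVec, dotProduct_sub, ← Matrix.mulVec_mulVec, Matrix.smul_mulVec,
    Matrix.one_mulVec, dotProduct_smul, Matrix.mulVec_smul, smul_dotProduct, smul_eq_mul]
  rw [Matrix.dotProduct_mulVec (feature v q), Matrix.vecMul_transpose]

/-- The random feature posterior mean is the Gaussian process posterior mean. -/
lemma feature_dotProduct_rfMean (hs : 0 < s) (hσ : 0 < σ)
    (hk : ∀ q q' : D, k q q' = s ^ 2 * (feature v q ⬝ᵥ feature v q')) {m : D → ℝ}
    {θ₀ : FeatIdx p → ℝ} (hm : ∀ q : D, m q = feature v q ⬝ᵥ θ₀)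
    (z : ℕ → Option (Fin n) → D) (y : ℕ → Option (Fin n) → ℝ) (t : ℕ) (q : D) :
    feature v q ⬝ᵥ (θ₀ + (1 / σ ^ 2) • (rfSigma v s σ z t *ᵥ ((featureMatrix v z t)ᵀ *ᵥ
      fun a => y (a.1 + 1) a.2 - feature v (z (a.1 + 1) a.2) ⬝ᵥ θ₀))) =
      gpMean m k σ z y t q := by
  have h : gpMean m k σ z y t q = m q + crossCov k (sampled z t) q ⬝ᵥ
      ((noisyGram k σ (sampled z t))⁻¹ *ᵥ fun a => y (a.1 + 1) a.2 - m (z (a.1 + 1) a.2)) := rfl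
  rw [h, Matrix.mulVec_mulVec, ← Matrix.smul_mulVec, rfSigma_mul_transpose hs hσ hk,
    crossCov_sampled hk, dotProduct_add, hm, Matrix.smul_mulVec, dotProduct_smul, smul_dotProduct,
    ← Matrix.mulVec_mulVec, Matrix.dotProduct_mulVec (feature v q), Matrix.vecMul_transpose]
  simp only [hm]

/-- The two regularized Gram matrices differ by the factor `σ ^ 2`, which reappears in front of the
inverse. -/
lemma rfTheta_eq (hs : 0 < s) (hσ : 0 < σ) (z : ℕ → Option (Fin n) → D)
    (y : ℕ → Option (Fin n) → ℝ) (t : ℕ) :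
    rfTheta v s σ z y t = (1 / σ ^ 2) • (rfSigma v s σ z t *ᵥ ((featureMatrix v z t)ᵀ *ᵥ
      fun a => y (a.1 + 1) a.2)) := by
  have hσ2 : σ ^ 2 ≠ 0 := by positivity
  have h : (featureMatrix v z t)ᵀ * featureMatrix v z t +
      (σ ^ 2 / s ^ 2) • (1 : Matrix (FeatIdx p) (FeatIdx p) ℝ) =
      σ ^ 2 • ((1 / σ ^ 2) • ((featureMatrix v z t)ᵀ * featureMatrix v z t) +
        (1 / s ^ 2) • 1) := by
    rw [smul_add, smul_smul, smul_smul, one_div, mul_inv_cancel₀ hσ2, one_smul, mul_one_div]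
  rw [rfTheta, h, rfSigma, ← Matrix.smul_mulVec]
  congr 1
  have hB := posDef_rfPrecision v (σ := σ) hs z t
  refine Matrix.inv_eq_right_inv ?_
  rw [Matrix.smul_mul, Matrix.mul_smul, smul_smul, mul_one_div_cancel hσ2, one_smul,
    Matrix.mul_nonsing_inv _ ((Matrix.isUnit_iff_isUnit_det _).1 hB.isUnit)]

lemma featureMatrix_succ_transpose_mulVec (z : ℕ → Option (Fin n) → D) (t : ℕ)
    (w : ℕ → Option (Fin n) → ℝ) :
    ((featureMatrix v z (t + 1))ᵀ *ᵥ fun a => w (a.1 + 1) a.2) =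
      ((featureMatrix v z t)ᵀ *ᵥ fun a => w (a.1 + 1) a.2) +
        stepFeatures v z (t + 1) *ᵥ w (t + 1) := by
  ext c
  simp [Matrix.mulVec, dotProduct, featureMatrix, stepFeatures, Fintype.sum_prod_type,
    Fin.sum_univ_castSucc]

lemma featureMatrix_succ_gram (z : ℕ → Option (Fin n) → D) (t : ℕ) :
    (featureMatrix v z (t + 1))ᵀ * featureMatrix v z (t + 1) =
      (featureMatrix v z t)ᵀ * featureMatrix v z t +
        stepFeatures v z (t + 1) * (stepFeatures v z (t + 1))ᵀ := by
  ext c d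
  simp [Matrix.mul_apply, featureMatrix, stepFeatures, Fintype.sum_prod_type,
    Fin.sum_univ_castSucc]

/-- The online recursion reproduces the batch posterior. -/
lemma onlineState_eq (hs : 0 < s) (hσ : 0 < σ) (θ₀ : FeatIdx p → ℝ)
    (z : ℕ → Option (Fin n) → D) (y : ℕ → Option (Fin n) → ℝ) (t : ℕ) :
    onlineState v s σ θ₀ z y t =
      (θ₀ + (1 / σ ^ 2) • (rfSigma v s σ z t *ᵥ ((featureMatrix v z t)ᵀ *ᵥ
        fun a => y (a.1 + 1) a.2 - feature v (z (a.1 + 1) a.2) ⬝ᵥ θ₀)), rfSigma v s σ z t) := by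
  induction t with
  | zero =>
    have hs2 : s ^ 2 ≠ 0 := by positivity
    have h0 : (featureMatrix v z 0)ᵀ * featureMatrix v z 0 = 0 := by
      ext; simp [Matrix.mul_apply]
    have h1 : rfSigma v s σ z 0 = s ^ 2 • 1 := by
      refine Matrix.inv_eq_right_inv ?_
      rw [h0, smul_zero, zero_add, Matrix.smul_mul, Matrix.one_mul, smul_smul, one_div,
        inv_mul_cancel₀ hs2, one_smul]
    have h2 : ((featureMatrix v z 0)ᵀ *ᵥ
        fun a => y (a.1 + 1) a.2 - feature v (z (a.1 + 1) a.2) ⬝ᵥ θ₀) = 0 := by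
      ext; simp [Matrix.mulVec, dotProduct]
    rw [onlineState, h2, h1, Matrix.mulVec_zero, smul_zero, add_zero]
  | succ t ih =>
    have hB := posDef_rfPrecision v (σ := σ) hs z t
    set B := (1 / σ ^ 2) • ((featureMatrix v z t)ᵀ * featureMatrix v z t) +
      (1 / s ^ 2) • (1 : Matrix (FeatIdx p) (FeatIdx p) ℝ) with hBdef
    set Ψ := stepFeatures v z (t + 1) with hΨ
    have hB' : (1 / σ ^ 2) • ((featureMatrix v z (t + 1))ᵀ * featureMatrix v z (t + 1)) +
        (1 / s ^ 2) • (1 : Matrix (FeatIdx p) (FeatIdx p) ℝ) = B + (1 / σ ^ 2) • (Ψ * Ψᵀ) := by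
      rw [featureMatrix_succ_gram, smul_add, hBdef]
      abel
    have hpos' := posDef_rfPrecision v (σ := σ) hs z (t + 1)
    have hSig : rfSigma v s σ z t = B⁻¹ := rfl
    have hSig' : rfSigma v s σ z (t + 1) = (B + (1 / σ ^ 2) • (Ψ * Ψᵀ))⁻¹ := by
      rw [rfSigma, hB']
    rw [hB'] at hpos'
    have hW := inv_add_smul_mul_transpose hB Ψ hσ
    have hG := mul_inv_eq_smul_inv_mul hB Ψ hσ
    rw [onlineState, ih]
    simp only
    rw [hSig, hSig', ← hΨ, ← hW, hG]
    refine Prod.ext ?_ rfl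
    rw [featureMatrix_succ_transpose_mulVec (w := fun i o => y i o - feature v (z i o) ⬝ᵥ θ₀)]
    set h := (featureMatrix v z t)ᵀ *ᵥ
      fun a => y (a.1 + 1) a.2 - feature v (z (a.1 + 1) a.2) ⬝ᵥ θ₀
    set B' := B + (1 / σ ^ 2) • (Ψ * Ψᵀ) with hB'def
    have hBi : B * B⁻¹ = 1 :=
      Matrix.mul_nonsing_inv _ ((Matrix.isUnit_iff_isUnit_det _).1 hB.isUnit)
    have hBi' : B'⁻¹ * B' = 1 :=
      Matrix.nonsing_inv_mul _ ((Matrix.isUnit_iff_isUnit_det _).1 hpos'.isUnit)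
    have hy : (fun o => y (t + 1) o - feature v (z (t + 1) o) ⬝ᵥ θ₀) = y (t + 1) - Ψᵀ *ᵥ θ₀ := by
      ext o; rfl
    -- `d` is the deviation of the current parameter from `θ₀`. Applying the new precision `B'` to
    -- it produces the old data term plus a term in `Ψᵀ *ᵥ d`.
    set d := (1 / σ ^ 2) • (B⁻¹ *ᵥ h) with hd
    have hBd : B' *ᵥ d = (1 / σ ^ 2) • h + (1 / σ ^ 2) • (Ψ *ᵥ (Ψᵀ *ᵥ d)) := by
      rw [hB'def, Matrix.add_mulVec, Matrix.smul_mulVec, ← Matrix.mulVec_mulVec]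
      congr 1
      rw [hd, Matrix.mulVec_smul, Matrix.mulVec_mulVec, hBi, Matrix.one_mulVec]
    have hdd : d = B'⁻¹ *ᵥ ((1 / σ ^ 2) • h + (1 / σ ^ 2) • (Ψ *ᵥ (Ψᵀ *ᵥ d))) := by
      rw [← hBd, Matrix.mulVec_mulVec, hBi', Matrix.one_mulVec]
    show θ₀ + d + ((1 / σ ^ 2) • (B'⁻¹ * Ψ)) *ᵥ (y (t + 1) - Ψᵀ *ᵥ (θ₀ + d)) =
      θ₀ + (1 / σ ^ 2) • (B'⁻¹ *ᵥ (h + Ψ *ᵥ (fun o => y (t + 1) o - feature v (z (t + 1) o) ⬝ᵥ θ₀)))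
    rw [hy, add_assoc]
    congr 1
    -- Only the isolated `d` is expanded; its `Ψᵀ *ᵥ d` part cancels the one inside the prediction
    -- error.
    conv_lhs => enter [1]; rw [hdd]
    simp only [Matrix.mulVec_add, Matrix.mulVec_sub, Matrix.smul_mulVec, Matrix.mulVec_smul,
      ← Matrix.mulVec_mulVec, smul_add, smul_sub]
    abel

end

variable {m : D → ℝ} {k : D → D → ℝ} {σ : ℝ}

lemma Estimator.mean_eq_gpMean (hσ : 0 < σ) {E : Estimator} (hE : E.HasPrior m k)
    (z : ℕ → Option (Fin n) → D) (y : ℕ → Option (Fin n) → ℝ) (t : ℕ) (q : D) :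
    E.mean m k σ z y t q = gpMean m k σ z y t q := by
  match E, hE with
  | .gp, _ => rfl
  | .rfgp p v s, ⟨hs, hm, hk⟩ =>
    rw [← feature_dotProduct_rfMean hs hσ hk (θ₀ := 0) (m := m) (by simpa using hm)]
    simp [Estimator.mean, rfTheta_eq hs hσ]
  | .orfgp p v s θ₀, ⟨hs, hm, hk⟩ =>
    rw [← feature_dotProduct_rfMean hs hσ hk hm]
    simp [Estimator.mean, onlineState_eq hs hσ]

lemma Estimator.sd_eq_gpVar (hσ : 0 < σ) {E : Estimator} (hE : E.HasPrior m k)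
    (z : ℕ → Option (Fin n) → D) (y : ℕ → Option (Fin n) → ℝ) (t : ℕ) (q : D) :
    E.sd k σ z y t q = √(gpVar k σ z t q) := by
  match E, hE with
  | .gp, _ => rfl
  | .rfgp p v s, ⟨hs, hm, hk⟩ =>
    rw [← feature_dotProduct_rfSigma hs hσ hk]; rfl
  | .orfgp p v s θ₀, ⟨hs, hm, hk⟩ =>
    rw [← feature_dotProduct_rfSigma hs hσ hk]
    simp [Estimator.sd, onlineState_eq hs hσ]

end Estimators

/-! ### The prediction error at fixed locations. -/

section GaussianModel

variable {Ω : Type*} [MeasurableSpace Ω] {P : Measure Ω} [IsProbabilityMeasure P]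
  {D : Finset Plane} {n : ℕ} {m : D → ℝ} {k : D → D → ℝ} {F : D → Ω → ℝ} {σ : ℝ}
  {x₀ : Ω → Fin n → D} {ε : ℕ → Option (Fin n) → Ω → ℝ}

lemma IsGP.hasGaussianLaw (hF : IsGP P m k F) : HasGaussianLaw (fun ω q => F q ω) P := by
  have h := hF.gaussian.hasGaussianLaw Finset.univ
  exact h.map_fun (ContinuousLinearMap.pi fun q : D =>
    ContinuousLinearMap.proj (R := ℝ) (φ := fun _ : (Finset.univ : Finset D) => ℝ)
      ⟨q, Finset.mem_univ q⟩)

lemma IsGP.memLp (hF : IsGP P m k F) (q : D) : MemLp (F q) 2 P :=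
  (hF.gaussian.hasGaussianLaw_eval q).memLp_two

/-- The quadratic form of `k` at `c` is the variance of the combination of field values with
coefficients `c`. -/
lemma IsGP.posSemidef (hF : IsGP P m k F) : (Matrix.of k).PosSemidef := by
  refine Matrix.PosSemidef.of_dotProduct_mulVec_nonneg ?_ fun c => ?_
  · ext q q'
    simp only [Matrix.conjTranspose_apply, Matrix.of_apply, star_trivial, ← hF.cov_eq]
    exact covariance_comm _ _
  · have h : star c ⬝ᵥ (Matrix.of k *ᵥ c) =
        Var[fun ω => ∑ q, c q * F q ω; P] := by
      rw [← covariance_self (by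
          have := hF.measurable
          fun_prop), covariance_fun_sum_fun_sum (fun q => (hF.memLp q).const_mul _)
        (fun q => (hF.memLp q).const_mul _)]
      simp only [dotProduct, Matrix.mulVec, Matrix.of_apply, star_trivial, Finset.mul_sum,
        covariance_const_mul_left, covariance_const_mul_right, hF.cov_eq]
      refine Finset.sum_congr rfl fun q _ => Finset.sum_congr rfl fun q' _ => ?_
      ring
    rw [h]
    exact variance_nonneg _ _

lemma IsNoise.hasGaussianLaw_eval (hε : IsNoise P σ F x₀ ε) (t : ℕ) (o : Option (Fin n)) :
    HasGaussianLaw (ε t o) P := by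
  have : IsGaussian (P.map (ε t o)) := by rw [hε.law]; infer_instance
  exact IsGaussian.hasGaussianLaw

lemma IsNoise.memLp (hε : IsNoise P σ F x₀ ε) (t : ℕ) (o : Option (Fin n)) :
    MemLp (ε t o) 2 P := (hε.hasGaussianLaw_eval t o).memLp_two

lemma IsNoise.covariance_field (hε : IsNoise P σ F x₀ ε) (hF : IsGP P m k F) (q : D) (t : ℕ)
    (o : Option (Fin n)) : cov[F q, ε t o; P] = 0 := by
  have h : IndepFun (F q) (ε t o) P := hε.indep_field.comp (φ := fun f : D → ℝ => f q)
    (ψ := fun e : ℕ × Option (Fin n) → ℝ => e (t, o)) (measurable_pi_apply q)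
    (measurable_pi_apply (t, o))
  exact h.covariance_eq_zero (hF.memLp q) (hε.memLp t o)

lemma IsNoise.covariance_noise (hε : IsNoise P σ F x₀ ε) (a b : ℕ × Option (Fin n)) :
    cov[ε a.1 a.2, ε b.1 b.2; P] = if a = b then σ ^ 2 else 0 := by
  split_ifs with hab
  · subst hab
    rw [covariance_self (hε.measurable _ _).aemeasurable,
      ← variance_id_map (hε.measurable _ _).aemeasurable, hε.law, variance_id_gaussianReal,
      Real.coe_toNNReal _ (sq_nonneg σ)]
  · exact (hε.iIndep.indepFun hab).covariance_eq_zero (hε.memLp _ _) (hε.memLp _ _)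

variable {ι : Type*} [Fintype ι] [DecidableEq ι]

/-- Independent Gaussian vectors are jointly Gaussian; injectivity of `e` keeps the noises of
different samples independent. -/
lemma IsNoise.hasGaussianLaw_joint (hε : IsNoise P σ F x₀ ε) (hF : IsGP P m k F)
    {e : ι → ℕ × Option (Fin n)} (he : Function.Injective e) :
    HasGaussianLaw (fun ω => ((fun q => F q ω), fun i => ε (e i).1 (e i).2 ω)) P := by
  refine IndepFun.hasGaussianLaw hF.hasGaussianLaw ?_ ?_
  · exact iIndepFun.hasGaussianLaw (X := fun i => ε (e i).1 (e i).2)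
      (fun i => hε.hasGaussianLaw_eval _ _) (hε.iIndep.precomp he)
  · exact hε.indep_field.comp (φ := id) (ψ := fun w i => w (e i)) measurable_id
      (measurable_pi_lambda _ fun i => measurable_pi_apply _)

/-- Noisy samples of the field at the fixed locations `z`, with noises `e`. -/
def noisySample (F : D → Ω → ℝ) (ε : ℕ → Option (Fin n) → Ω → ℝ) (e : ι → ℕ × Option (Fin n))
    (z : ι → D) (i : ι) (ω : Ω) : ℝ := F (z i) ω + ε (e i).1 (e i).2 ω

/-- The error of the linear predictor with weights `a` of the field at `q`, up to a constant. -/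
def predErr (F : D → Ω → ℝ) (ε : ℕ → Option (Fin n) → Ω → ℝ) (e : ι → ℕ × Option (Fin n))
    (z : ι → D) (q : D) (a : ι → ℝ) (ω : Ω) : ℝ := F q ω - ∑ i, a i * noisySample F ε e z i ω

lemma memLp_noisySample (hε : IsNoise P σ F x₀ ε) (hF : IsGP P m k F)
    (e : ι → ℕ × Option (Fin n)) (z : ι → D) (i : ι) : MemLp (noisySample F ε e z i) 2 P :=
  (hF.memLp _).add (hε.memLp _ _)

lemma covariance_noisySample (hε : IsNoise P σ F x₀ ε) (hF : IsGP P m k F)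
    {e : ι → ℕ × Option (Fin n)} (he : Function.Injective e) (z : ι → D) (i j : ι) :
    cov[noisySample F ε e z i, noisySample F ε e z j; P] = noisyGram k σ z i j := by
  have h1 : cov[ε (e i).1 (e i).2, F (z j); P] = 0 := by
    rw [covariance_comm]; exact hε.covariance_field hF _ _ _
  have h2 : ∀ i, noisySample F ε e z i = F (z i) + ε (e i).1 (e i).2 := fun i => rfl
  rw [h2, h2, covariance_add_left (hF.memLp _) (hε.memLp _ _) ((hF.memLp _).add (hε.memLp _ _)),
    covariance_add_right (hF.memLp _) (hF.memLp _) (hε.memLp _ _),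
    covariance_add_right (hε.memLp _ _) (hF.memLp _) (hε.memLp _ _), h1,
    hε.covariance_field hF, hε.covariance_noise, hF.cov_eq]
  simp [noisyGram, Matrix.one_apply, he.eq_iff]

lemma covariance_field_noisySample (hε : IsNoise P σ F x₀ ε) (hF : IsGP P m k F)
    (e : ι → ℕ × Option (Fin n)) (z : ι → D) (q : D) (j : ι) :
    cov[F q, noisySample F ε e z j; P] = crossCov k z q j := by
  have h2 : ∀ i, noisySample F ε e z i = F (z i) + ε (e i).1 (e i).2 := fun i => rfl
  rw [h2, covariance_add_right (hF.memLp _) (hF.memLp _) (hε.memLp _ _),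
    hε.covariance_field hF, covariance_comm, hF.cov_eq, add_zero, crossCov]

lemma covariance_predErr_left (hε : IsNoise P σ F x₀ ε) (hF : IsGP P m k F)
    (e : ι → ℕ × Option (Fin n)) (z : ι → D) (q : D) (a : ι → ℝ) {X : Ω → ℝ} (hX : MemLp X 2 P) :
    cov[predErr F ε e z q a, X; P] =
      cov[F q, X; P] - ∑ i, a i * cov[noisySample F ε e z i, X; P] := by
  have h2 : predErr F ε e z q a = F q - fun ω => ∑ i, a i * noisySample F ε e z i ω := rfl
  have hL : ∀ i, MemLp (fun ω => a i * noisySample F ε e z i ω) 2 P := fun i =>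
    (memLp_noisySample hε hF e z i).const_mul _
  rw [h2, covariance_sub_left (hF.memLp _) (memLp_finsetSum _ fun i _ => hL i) hX,
    covariance_fun_sum_left hL hX]
  simp only [covariance_const_mul_left]

lemma memLp_predErr (hε : IsNoise P σ F x₀ ε) (hF : IsGP P m k F)
    (e : ι → ℕ × Option (Fin n)) (z : ι → D) (q : D) (a : ι → ℝ) :
    MemLp (predErr F ε e z q a) 2 P :=
  (hF.memLp _).sub
    (memLp_finsetSum _ fun i _ => (memLp_noisySample hε hF e z i).const_mul _)

/-- The kriging weights solve the normal equations, which say that the error is uncorrelated with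
every sample. -/
lemma covariance_predErr_noisySample (hσ : 0 < σ) (hε : IsNoise P σ F x₀ ε) (hF : IsGP P m k F)
    {e : ι → ℕ × Option (Fin n)} (he : Function.Injective e) (z : ι → D) (q : D) (j : ι) :
    cov[predErr F ε e z q (krigWeights k σ z q), noisySample F ε e z j; P] = 0 := by
  rw [covariance_predErr_left hε hF _ _ _ _ (memLp_noisySample hε hF e z j),
    covariance_field_noisySample hε hF]
  simp only [covariance_noisySample hε hF he]
  rw [← noisyGram_mulVec_krigWeights hF.posSemidef hσ z q, sub_eq_zero]
  have hs : ∀ i, noisyGram k σ z j i = noisyGram k σ z i j := fun i => by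
    simpa using (posDef_noisyGram hF.posSemidef hσ z).isHermitian.apply i j
  simp only [Matrix.mulVec, dotProduct, hs]
  exact Finset.sum_congr rfl fun i _ => mul_comm _ _

/-- As the error is orthogonal to the predictor, its variance equals its covariance with the field
value alone. -/
lemma variance_predErr (hσ : 0 < σ) (hε : IsNoise P σ F x₀ ε) (hF : IsGP P m k F)
    {e : ι → ℕ × Option (Fin n)} (he : Function.Injective e) (z : ι → D) (q : D) :
    Var[predErr F ε e z q (krigWeights k σ z q); P] = krigVar k σ z q := by
  have hW := memLp_predErr hε hF e z q (krigWeights k σ z q)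
  have h0 : ∀ i, cov[noisySample F ε e z i, predErr F ε e z q (krigWeights k σ z q); P] = 0 :=
    fun i => by rw [covariance_comm]; exact covariance_predErr_noisySample hσ hε hF he z q i
  rw [← covariance_self hW.aestronglyMeasurable.aemeasurable,
    covariance_predErr_left hε hF _ _ _ _ hW]
  simp only [h0, mul_zero, Finset.sum_const_zero, sub_zero]
  rw [covariance_comm, covariance_predErr_left hε hF _ _ _ _ (hF.memLp q), hF.cov_eq, krigVar,
    dotProduct]
  congr 1
  refine Finset.sum_congr rfl fun i _ => ?_
  rw [covariance_comm, covariance_field_noisySample hε hF, mul_comm]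

lemma integral_predErr (hε : IsNoise P σ F x₀ ε) (hF : IsGP P m k F)
    (e : ι → ℕ × Option (Fin n)) (z : ι → D) (q : D) (a : ι → ℝ) :
    ∫ ω, predErr F ε e z q a ω ∂P = m q - ∑ i, a i * m (z i) := by
  have hi : ∀ q, Integrable (F q) P := fun q => (hF.memLp q).integrable (by norm_num)
  have hi' : ∀ t o, Integrable (ε t o) P := fun t o => (hε.memLp t o).integrable (by norm_num)
  have h0 : ∀ t o, ∫ ω, ε t o ω ∂P = 0 := fun t o => by
    rw [← integral_map (hε.measurable t o).aemeasurable (f := fun x => x)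
      measurable_id.aestronglyMeasurable, hε.law, integral_id_gaussianReal]
  have hs : ∀ i, Integrable (noisySample F ε e z i) P := fun i => (hi _).add (hi' _ _)
  unfold predErr
  rw [integral_sub (hi q) (integrable_finsetSum _ fun i _ => (hs i).const_mul _), hF.mean_eq,
    integral_finsetSum _ fun i _ => (hs i).const_mul _]
  congr 1
  refine Finset.sum_congr rfl fun i _ => ?_
  rw [integral_const_mul]
  unfold noisySample
  rw [integral_add (hi _) (hi' _ _), hF.mean_eq, h0, add_zero]

/-- Error and samples are linear images of one Gaussian vector. The scalar error is indexed by
`Unit` because the criterion for independence compares two families of coordinates. -/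
lemma hasGaussianLaw_predErr_noisySample (hε : IsNoise P σ F x₀ ε) (hF : IsGP P m k F)
    {e : ι → ℕ × Option (Fin n)} (he : Function.Injective e) (z : ι → D) (q : D) (a : ι → ℝ) :
    HasGaussianLaw (fun ω => ((fun _ : Unit => predErr F ε e z q a ω),
      fun i => noisySample F ε e z i ω)) P := by
  let pF : D → ((D → ℝ) × (ι → ℝ) →L[ℝ] ℝ) := fun q =>
    (ContinuousLinearMap.proj (R := ℝ) (φ := fun _ : D => ℝ) q).comp
      (ContinuousLinearMap.fst ℝ (D → ℝ) (ι → ℝ))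
  let pE : ι → ((D → ℝ) × (ι → ℝ) →L[ℝ] ℝ) := fun i =>
    (ContinuousLinearMap.proj (R := ℝ) (φ := fun _ : ι => ℝ) i).comp
      (ContinuousLinearMap.snd ℝ (D → ℝ) (ι → ℝ))
  have h := (hε.hasGaussianLaw_joint hF he).map_fun
    ((ContinuousLinearMap.pi fun _ : Unit => pF q - ∑ i, a i • (pF (z i) + pE i)).prod
      (ContinuousLinearMap.pi fun i => pF (z i) + pE i))
  refine h.congr (Filter.Eventually.of_forall fun ω => Prod.ext ?_ ?_)
  · ext
    simp [predErr, noisySample, pF, pE, mul_add]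
  · ext i
    simp [noisySample, pF, pE]

/-- Joint Gaussianity upgrades zero covariance to independence; this is what makes adaptive sampling
harmless. -/
lemma indepFun_predErr_noisySample (hσ : 0 < σ) (hε : IsNoise P σ F x₀ ε) (hF : IsGP P m k F)
    {e : ι → ℕ × Option (Fin n)} (he : Function.Injective e) (z : ι → D) (q : D) :
    IndepFun (predErr F ε e z q (krigWeights k σ z q)) (fun ω i => noisySample F ε e z i ω) P := by
  have h := HasGaussianLaw.indepFun_of_covariance_eval
    (hasGaussianLaw_predErr_noisySample hε hF he z q (krigWeights k σ z q))
    (fun _ j => covariance_predErr_noisySample hσ hε hF he z q j)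
  exact h.comp (φ := fun f : Unit → ℝ => f ()) (ψ := id) (measurable_pi_apply ()) measurable_id

lemma hasGaussianLaw_predErr (hε : IsNoise P σ F x₀ ε) (hF : IsGP P m k F)
    {e : ι → ℕ × Option (Fin n)} (he : Function.Injective e) (z : ι → D) (q : D) (a : ι → ℝ) :
    HasGaussianLaw (predErr F ε e z q a) P :=
  (hasGaussianLaw_predErr_noisySample hε hF he z q a).fst.eval ()

end GaussianModel

/-! ### Gaussian tails. -/

section Tail

/-- After translation by `c`, the cross term in `(x + c) ^ 2` is nonnegative for `x > 0`. Keeping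
the mass of the half-line as a factor lets the two tails add up without a factor `2`, as the choice
of `β_t` requires. -/
lemma gaussianReal_Ioi_le {c : ℝ} (hc : 0 ≤ c) :
    gaussianReal 0 1 (Set.Ioi c) ≤
      ENNReal.ofReal (Real.exp (-c ^ 2 / 2)) * gaussianReal 0 1 (Set.Ioi 0) := by
  rw [gaussianReal_apply _ one_ne_zero, gaussianReal_apply _ one_ne_zero,
    ← lintegral_const_mul _ (measurable_gaussianPDF 0 1), ← lintegral_indicator measurableSet_Ioi,
    ← lintegral_indicator measurableSet_Ioi,
    ← lintegral_add_right_eq_self _ c]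
  refine lintegral_mono fun x => ?_
  by_cases hx : 0 < x
  · rw [Set.indicator_of_mem (by simpa using hx), Set.indicator_of_mem (by simpa using hx)]
    rw [gaussianPDF, gaussianPDF, ← ENNReal.ofReal_mul (Real.exp_nonneg _)]
    refine ENNReal.ofReal_le_ofReal ?_
    simp only [gaussianPDFReal, NNReal.coe_one, mul_one, sub_zero]
    rw [mul_left_comm, ← Real.exp_add]
    gcongr
    nlinarith [mul_nonneg hc hx.le]
  · rw [Set.indicator_of_notMem (by simpa using hx)]
    exact zero_le

lemma gaussianReal_Iio_neg (c : ℝ) :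
    gaussianReal 0 1 (Set.Iio (-c)) = gaussianReal 0 1 (Set.Ioi c) := by
  have h := gaussianReal_map_neg (μ := 0) (v := 1)
  rw [neg_zero] at h
  conv_lhs => rw [← h]
  rw [Measure.map_apply measurable_neg measurableSet_Iio]
  congr 1
  ext x
  simp

/-- The two-sided tail bound for the standard normal distribution. -/
lemma gaussianReal_lt_abs_le {c : ℝ} (hc : 0 ≤ c) :
    gaussianReal 0 1 {x | c < |x|} ≤ ENNReal.ofReal (Real.exp (-c ^ 2 / 2)) := by
  have hset : {x : ℝ | c < |x|} = Set.Ioi c ∪ Set.Iio (-c) := by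
    ext x
    simp only [Set.mem_ofPred_eq, lt_abs, Set.mem_union, Set.mem_Ioi, Set.mem_Iio]
    rw [lt_neg]
  have h0 : gaussianReal 0 1 (Set.Ioi 0) + gaussianReal 0 1 (Set.Iio (-0)) ≤ 1 := by
    rw [← measure_union (by
      rw [neg_zero]; exact Set.disjoint_left.2 fun x hx hx' => lt_asymm (Set.mem_Ioi.1 hx) (Set.mem_Iio.1 hx')) measurableSet_Iio]
    exact prob_le_one
  calc gaussianReal 0 1 {x | c < |x|}
      ≤ gaussianReal 0 1 (Set.Ioi c) + gaussianReal 0 1 (Set.Iio (-c)) := by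
        rw [hset]; exact measure_union_le _ _
    _ ≤ ENNReal.ofReal (Real.exp (-c ^ 2 / 2)) *
        (gaussianReal 0 1 (Set.Ioi 0) + gaussianReal 0 1 (Set.Iio (-0))) := by
        rw [mul_add, gaussianReal_Iio_neg, gaussianReal_Iio_neg]
        exact add_le_add (gaussianReal_Ioi_le hc) (gaussianReal_Ioi_le hc)
    _ ≤ _ := mul_le_of_le_one_right' h0

lemma HasGaussianLaw.measure_lt_abs_sub_le {Ω : Type*} [MeasurableSpace Ω] {P : Measure Ω}
    {X : Ω → ℝ} (hX : HasGaussianLaw X P) {β : ℝ} (hβ : 0 ≤ β) :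
    P {ω | √β * √(Var[X; P]) < |X ω - ∫ ω', X ω' ∂P|} ≤
      ENNReal.ofReal (Real.exp (-β / 2)) := by
  set v := Var[X; P] with hv
  have hv0 : 0 ≤ v := variance_nonneg _ _
  set μ := ∫ ω', X ω' ∂P with hμ
  -- This affine form of the law also covers variance zero.
  have hlaw : P.map X = (gaussianReal 0 1).map fun g => μ + √v * g := by
    have h1 := gaussianReal_map_const_mul (μ := 0) (v := 1) (√v)
    have h2 := gaussianReal_map_const_add (μ := √v * 0) (v := NNReal.mk ((√v) ^ 2) (sq_nonneg _) * 1) μ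
    rw [← h1, Measure.map_map (by fun_prop) (by fun_prop)] at h2
    rw [hX.map_eq_gaussianReal, ← hμ, ← hv]
    refine Eq.trans ?_ h2.symm
    congr 1
    · ring
    · ext
      simp [Real.sq_sqrt hv0, hv0]
  have hm : MeasurableSet {x : ℝ | √β * √v < |x - μ|} :=
    measurableSet_lt measurable_const (by fun_prop)
  calc P {ω | √β * √v < |X ω - μ|} = P.map X {x : ℝ | √β * √v < |x - μ|} :=
        (Measure.map_apply_of_aemeasurable hX.aemeasurable hm).symm
    _ = gaussianReal 0 1 {g | √β * √v < |μ + √v * g - μ|} := by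
        rw [hlaw, Measure.map_apply (by fun_prop) hm]; rfl
    _ ≤ gaussianReal 0 1 {g | √β < |g|} := by
        -- The factor `√v` is cancelled from a strict inequality, so it only has to be nonnegative.
        refine measure_mono fun g hg => ?_
        simp only [Set.mem_ofPred_eq, add_sub_cancel_left, abs_mul,
          abs_of_nonneg (Real.sqrt_nonneg v)] at hg ⊢
        rw [mul_comm] at hg
        exact lt_of_mul_lt_mul_left hg (Real.sqrt_nonneg v)
    _ ≤ ENNReal.ofReal (Real.exp (-(√β) ^ 2 / 2)) := gaussianReal_lt_abs_le (Real.sqrt_nonneg β)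
    _ = _ := by rw [Real.sq_sqrt hβ]

end Tail

/-! ### Adding independent initial positions. -/

section Independence

/-- Both hypotheses factor the joint law into three marginals, which can be regrouped. It is applied
with `X` the prediction error, `Y` the samples and `Z` the initial positions. -/
lemma IndepFun.prodMk_right_of_prodMk {Ω α β γ : Type*} [MeasurableSpace Ω] [MeasurableSpace α]
    [MeasurableSpace β] [MeasurableSpace γ] {P : Measure Ω} [IsProbabilityMeasure P]
    {X : Ω → α} {Y : Ω → β} {Z : Ω → γ} (hX : Measurable X) (hY : Measurable Y) (hZ : Measurable Z)
    (hXY : IndepFun X Y P) (hZXY : IndepFun Z (fun ω => (X ω, Y ω)) P) :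
    IndepFun X (fun ω => (Z ω, Y ω)) P := by
  have hZY : IndepFun Z Y P := hZXY.comp (φ := id) (ψ := Prod.snd) measurable_id measurable_snd
  have := Measure.isProbabilityMeasure_map (μ := P) hX.aemeasurable
  have := Measure.isProbabilityMeasure_map (μ := P) hY.aemeasurable
  have := Measure.isProbabilityMeasure_map (μ := P) hZ.aemeasurable
  rw [indepFun_iff_map_prod_eq_prod_map_map hX.aemeasurable (hZ.prodMk hY).aemeasurable,
    (indepFun_iff_map_prod_eq_prod_map_map hZ.aemeasurable hY.aemeasurable).1 hZY]
  rw [indepFun_iff_map_prod_eq_prod_map_map hZ.aemeasurable (hX.prodMk hY).aemeasurable,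
    (indepFun_iff_map_prod_eq_prod_map_map hX.aemeasurable hY.aemeasurable).1 hXY] at hZXY
  set μ := P.map X
  set ν := P.map Y
  set τ := P.map Z
  have h1 := (measurePreserving_prodAssoc μ τ ν).comp
    (((Measure.measurePreserving_swap (μ := τ) (ν := μ)).prod (MeasurePreserving.id ν)).comp
      ((measurePreserving_prodAssoc τ μ ν).symm))
  rw [← h1.map_eq, ← hZXY, Measure.map_map h1.measurable (by fun_prop)]
  rfl

end Independence

/-! ### Calibration under adaptive sampling. -/

section Adaptive

/-- The sets whose trace on `A` is measurable. -/
abbrev traceSpace {Ω : Type*} (𝒢 : MeasurableSpace Ω) (A : Set Ω) (hA : MeasurableSet[𝒢] A) :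
    MeasurableSpace Ω where
  MeasurableSet' B := MeasurableSet[𝒢] (A ∩ B)
  measurableSet_empty := by simp
  measurableSet_compl B hB := by
    have : A ∩ Bᶜ = A \ (A ∩ B) := by ext; simp +contextual
    rw [this]
    exact hA.diff hB
  measurableSet_iUnion f hf := by
    rw [Set.inter_iUnion]
    exact MeasurableSet.iUnion hf

variable {Ω : Type*} [mΩ : MeasurableSpace Ω] {P : Measure Ω} [IsProbabilityMeasure P]
  {D : Finset Plane} {n : ℕ} {m : D → ℝ} {k : D → D → ℝ} {F : D → Ω → ℝ} {σ : ℝ}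
  {x₀ : Ω → Fin n → D} {ε : ℕ → Option (Fin n) → Ω → ℝ}

/-- The noise indices of the measurements at times `1, …, N`. -/
def noiseIdx (n N : ℕ) (a : DataIdx n N) : ℕ × Option (Fin n) := (a.1 + 1, a.2)

lemma noiseIdx_injective (n N : ℕ) : Function.Injective (noiseIdx n N) := by
  rintro ⟨i, o⟩ ⟨j, o'⟩ h
  simp only [noiseIdx, Prod.mk.injEq, add_left_inj] at h
  exact Prod.ext (Fin.ext h.1) h.2

/-- The event that adaptively chosen locations follow a fixed trajectory is determined by the
initial positions and the samples along that trajectory. -/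
lemma measurableSet_trajectory {Z : ℕ → Option (Fin n) → Ω → D}
    {Y : ℕ → Option (Fin n) → Ω → ℝ} (hY : ∀ t o ω, Y t o ω = F (Z t o ω) ω + ε t o ω)
    (hZ : ∀ t, 1 ≤ t → ∀ o, Measurable[history x₀ Y t] (Z t o)) (N : ℕ) (ζ : DataIdx n N → D) :
    MeasurableSet[MeasurableSpace.comap
        (fun ω => (x₀ ω, fun a => noisySample F ε (noiseIdx n N) ζ a ω)) inferInstance]
      {ω | ∀ a : DataIdx n N, Z (a.1 + 1) a.2 ω = ζ a} := by
  set 𝒢 : MeasurableSpace Ω := MeasurableSpace.comap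
    (fun ω => (x₀ ω, fun a => noisySample F ε (noiseIdx n N) ζ a ω)) inferInstance with h𝒢
  have hpair : Measurable[𝒢] (fun ω => (x₀ ω, fun a => noisySample F ε (noiseIdx n N) ζ a ω)) :=
    comap_measurable _
  have hx₀ : Measurable[𝒢] x₀ := measurable_fst.comp hpair
  have hsample : ∀ a, Measurable[𝒢] (noisySample F ε (noiseIdx n N) ζ a) := fun a =>
    (measurable_pi_apply a).comp (measurable_snd.comp hpair)
  -- Induction over time: once the locations agree with `ζ` before step `s`, the next choice depends
  -- only on data that are samples along `ζ`.
  have key : ∀ s ≤ N, MeasurableSet[𝒢]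
      {ω | ∀ a : DataIdx n N, (a.1 : ℕ) < s → Z (a.1 + 1) a.2 ω = ζ a} := by
    intro s
    induction s with
    | zero => intro _; simp
    | succ s ih =>
      intro hs
      have hA := ih (by omega)
      set A := {ω | ∀ a : DataIdx n N, (a.1 : ℕ) < s → Z (a.1 + 1) a.2 ω = ζ a} with hAdef
      -- On `A` the actual measurements coincide with the samples along `ζ`. As `traceSpace` is a
      -- σ-algebra, it suffices to check the generators of the history.
      have hle : history x₀ Y (s + 1) ≤ traceSpace 𝒢 A hA := by
        refine sup_le ?_ (iSup₂_le fun i hi => iSup_le fun o => ?_)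
        · rintro _ ⟨S, hS, rfl⟩
          exact hA.inter (hx₀ hS)
        · rintro _ ⟨S, hS, rfl⟩
          obtain ⟨j, rfl⟩ : ∃ j, i = j + 1 := ⟨i - 1, by have := hi.1; omega⟩
          have hj : j < s := by have := hi.2; omega
          have heq : A ∩ Y (j + 1) o ⁻¹' S =
              A ∩ noisySample F ε (noiseIdx n N) ζ (⟨j, by omega⟩, o) ⁻¹' S := by
            ext ω
            refine and_congr_right fun hω => ?_
            have := hω (⟨j, by omega⟩, o) hj
            simp only [Set.mem_preimage, hY, noisySample, noiseIdx]
            rw [← this]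
          show MeasurableSet[𝒢] (A ∩ Y (j + 1) o ⁻¹' S)
          rw [heq]
          exact hA.inter (hsample _ hS)
      have hstep : {ω | ∀ a : DataIdx n N, (a.1 : ℕ) < s + 1 → Z (a.1 + 1) a.2 ω = ζ a} =
          A ∩ ⋂ o, (A ∩ Z (s + 1) o ⁻¹' {ζ (⟨s, hs⟩, o)}) := by
        ext ω
        simp only [hAdef, Set.mem_inter_iff, Set.mem_iInter, Set.mem_ofPred_eq, Set.mem_preimage,
          Set.mem_singleton_iff]
        constructor
        · exact fun h => ⟨fun a ha => h a (by omega), fun o => ⟨fun a ha => h a (by omega),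
            h (⟨s, hs⟩, o) (Nat.lt_succ_self s)⟩⟩
        · rintro ⟨h1, h2⟩ ⟨⟨i, hi⟩, o⟩ ha
          rcases Nat.lt_succ_iff_lt_or_eq.1 ha with h | h
          · exact h1 _ h
          · obtain rfl : i = s := h
            exact (h2 o).2
      rw [hstep]
      refine hA.inter (MeasurableSet.iInter fun o => ?_)
      exact hle _ (hZ (s + 1) (by omega) o (MeasurableSet.singleton _))
  have h := key N le_rfl
  have heq : {ω | ∀ a : DataIdx n N, (a.1 : ℕ) < N → Z (a.1 + 1) a.2 ω = ζ a} =
      {ω | ∀ a : DataIdx n N, Z (a.1 + 1) a.2 ω = ζ a} := by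
    ext ω
    exact ⟨fun h a => h a a.1.2, fun h a _ => h a⟩
  rwa [heq] at h

/-- The posterior after adaptively chosen measurements is calibrated. -/
lemma measure_lt_abs_sub_gpMean_le (hσ : 0 < σ) (hF : IsGP P m k F) (hε : IsNoise P σ F x₀ ε)
    {Z : ℕ → Option (Fin n) → Ω → D}
    {Y : ℕ → Option (Fin n) → Ω → ℝ} (hY : ∀ t o ω, Y t o ω = F (Z t o ω) ω + ε t o ω)
    (hZ : ∀ t, 1 ≤ t → ∀ o, Measurable[history x₀ Y t] (Z t o)) (N : ℕ) (q : D) {β : ℝ}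
    (hβ : 0 ≤ β) :
    P {ω | √β * √(gpVar k σ (fun t o => Z t o ω) N q) <
        |F q ω - gpMean m k σ (fun t o => Z t o ω) (fun t o => Y t o ω) N q|} ≤
      ENNReal.ofReal (Real.exp (-β / 2)) := by
  set traj : Ω → DataIdx n N → D := fun ω a => Z (a.1 + 1) a.2 ω with htraj
  have he := noiseIdx_injective n N
  have hsm : ∀ ζ : DataIdx n N → D,
      Measurable (fun ω a => noisySample F ε (noiseIdx n N) ζ a ω) := fun ζ =>
    measurable_pi_lambda _ fun a => (hF.measurable _).add (hε.measurable _ _)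
  have hpm : ∀ ζ : DataIdx n N → D,
      Measurable (predErr F ε (noiseIdx n N) ζ q (krigWeights k σ ζ q)) := fun ζ =>
    (hF.measurable q).sub (Finset.measurable_sum _ fun a _ =>
      ((hF.measurable _).add (hε.measurable _ _)).const_mul _)
  have hmeas : ∀ ζ, MeasurableSet[MeasurableSpace.comap
      (fun ω => (x₀ ω, fun a => noisySample F ε (noiseIdx n N) ζ a ω)) inferInstance]
      (traj ⁻¹' {ζ}) := fun ζ => by
    convert measurableSet_trajectory hY hZ N ζ using 1
    ext ω
    simp [htraj, funext_iff]
  have hmeas' : ∀ ζ, MeasurableSet (traj ⁻¹' {ζ}) := fun ζ =>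
    (hε.measurable_init.prodMk (hsm ζ)).comap_le _ (hmeas ζ)
  set bad := {ω | √β * √(gpVar k σ (fun t o => Z t o ω) N q) <
        |F q ω - gpMean m k σ (fun t o => Z t o ω) (fun t o => Y t o ω) N q|} with hbad
  -- With the trajectory frozen at `ζ`, the bad event is contained in a tail event of the
  -- fixed-location error. That set is measurable, so measurability of `bad` itself is not required.
  have hpiece : ∀ ζ : DataIdx n N → D, P (traj ⁻¹' {ζ} ∩ bad) ≤
      P (traj ⁻¹' {ζ}) * ENNReal.ofReal (Real.exp (-β / 2)) := by
    intro ζ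
    set W := predErr F ε (noiseIdx n N) ζ q (krigWeights k σ ζ q) with hW
    set c := √β * √(Var[W; P]) with hc
    have hcm : MeasurableSet {x : ℝ | c < |x - ∫ ω', W ω' ∂P|} :=
      measurableSet_lt measurable_const (by fun_prop)
    have hsub : traj ⁻¹' {ζ} ∩ bad ⊆ W ⁻¹' {x | c < |x - ∫ ω', W ω' ∂P|} ∩ traj ⁻¹' {ζ} := by
      rintro ω ⟨hω, hb⟩
      refine ⟨?_, hω⟩
      have hω' : sampled (fun t o => Z t o ω) N = ζ := hω
      have hωa : ∀ a : DataIdx n N, Z (a.1 + 1) a.2 ω = ζ a := fun a => congrFun hω' a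
      rw [hbad, Set.mem_ofPred_eq, gpVar_eq_krigVar, gpMean_eq k hF.posSemidef hσ, hω'] at hb
      simp only [Set.mem_preimage, Set.mem_ofPred_eq]
      rw [hc, hW, variance_predErr hσ hε hF he, integral_predErr hε hF]
      convert hb using 2
      simp only [predErr, noisySample, dotProduct, noiseIdx, hY, hωa, mul_sub,
        Finset.sum_sub_distrib]
      ring
    -- The event of following `ζ` lies in the σ-algebra of this pair, so independence multiplies its
    -- probability by that of the tail.
    have hI : IndepFun W (fun ω => (x₀ ω, fun a => noisySample F ε (noiseIdx n N) ζ a ω)) P := by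
      refine IndepFun.prodMk_right_of_prodMk (hpm ζ) (hsm ζ) hε.measurable_init
        (indepFun_predErr_noisySample hσ hε hF he ζ q) ?_
      exact hε.indep_init.comp (φ := id)
        (ψ := fun w : (D → ℝ) × (ℕ × Option (Fin n) → ℝ) =>
          (w.1 q - ∑ a, krigWeights k σ ζ q a * (w.1 (ζ a) + w.2 (noiseIdx n N a)),
            fun a => w.1 (ζ a) + w.2 (noiseIdx n N a))) measurable_id (by fun_prop)
    have hInd := (IndepFun_iff_Indep _ _ _).1 hI
    calc P (traj ⁻¹' {ζ} ∩ bad) ≤ P (W ⁻¹' {x | c < |x - ∫ ω', W ω' ∂P|} ∩ traj ⁻¹' {ζ}) :=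
          measure_mono hsub
      _ = P (W ⁻¹' {x | c < |x - ∫ ω', W ω' ∂P|}) * P (traj ⁻¹' {ζ}) :=
          (Indep_iff _ _ _).1 hInd _ _ ⟨_, hcm, rfl⟩ (hmeas ζ)
      _ ≤ _ := by
          rw [mul_comm]
          gcongr
          exact HasGaussianLaw.measure_lt_abs_sub_le (hasGaussianLaw_predErr hε hF he ζ q _) hβ
  calc P bad ≤ P (⋃ ζ, traj ⁻¹' {ζ} ∩ bad) := measure_mono fun ω hω =>
        Set.mem_iUnion.2 ⟨traj ω, rfl, hω⟩
    _ ≤ ∑ ζ, P (traj ⁻¹' {ζ} ∩ bad) := measure_iUnion_fintype_le _ _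
    _ ≤ ∑ ζ, P (traj ⁻¹' {ζ}) * ENNReal.ofReal (Real.exp (-β / 2)) :=
        Finset.sum_le_sum fun ζ _ => hpiece ζ
    _ = ENNReal.ofReal (Real.exp (-β / 2)) := by
        rw [← Finset.sum_mul, sum_measure_preimage_singleton _ fun ζ _ => hmeas' ζ]
        simp

end Adaptive

/-! ### Densities and mutual information. -/

section Densities

/-- A change of variables that leaves the image of the base measure to be computed separately; it
serves for the shear `(x, u) ↦ (x, x + u)` and for linear maps. -/
lemma map_withDensity_of_leftInverse {α β : Type*} [MeasurableSpace α] [MeasurableSpace β]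
    {μ : Measure α} {f : α → ENNReal} (hf : Measurable f) {s : α → β} (hs : Measurable s)
    {r : β → α} (hr : Measurable r) (hrs : Function.LeftInverse r s) :
    (μ.withDensity f).map s = (μ.map s).withDensity (f ∘ r) := by
  ext A hA
  rw [Measure.map_apply hs hA, withDensity_apply _ (hs hA), withDensity_apply _ hA,
    setLIntegral_map hA (hf.comp hr) hs]
  simp [hrs _]

/-- The density of a product of nondegenerate normal distributions. -/
lemma pi_gaussianReal_eq_withDensity {ι : Type*} [Fintype ι] (b : ι → ℝ) {v : NNReal}
    (hv : v ≠ 0) :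
    Measure.pi (fun i => gaussianReal (b i) v) =
      (volume : Measure (ι → ℝ)).withDensity
        fun x => ENNReal.ofReal (∏ i, gaussianPDFReal (b i) v (x i)) := by
  refine Measure.pi_eq fun s hs => ?_
  rw [withDensity_apply _ (MeasurableSet.univ_pi hs), volume_pi, Measure.restrict_pi_pi,
    ← ofReal_integral_eq_lintegral_ofReal]
  · rw [integral_fintype_prod_eq_prod,
      ENNReal.ofReal_prod_of_nonneg fun i _ => integral_nonneg (gaussianPDFReal_nonneg _ _)]
    refine Finset.prod_congr rfl fun i _ => ?_
    rw [gaussianReal_apply_eq_integral _ hv]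
  · exact Integrable.fintype_prod fun i => (integrable_gaussianPDFReal _ _).restrict
  · exact Eventually.of_forall fun x => Finset.prod_nonneg fun i _ => gaussianPDFReal_nonneg _ _ _

lemma log_gaussianPDFReal (b : ℝ) {v : NNReal} (hv : v ≠ 0) (x : ℝ) :
    Real.log (gaussianPDFReal b v x) =
      -(Real.log (2 * Real.pi) + Real.log v) / 2 - (x - b) ^ 2 / (2 * v) := by
  have hv' : (0 : ℝ) < v := by positivity
  rw [gaussianPDFReal, Real.log_mul (by positivity) (Real.exp_ne_zero _), Real.log_exp,
    Real.log_inv, Real.log_sqrt (by positivity), Real.log_mul (by positivity) hv'.ne']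
  ring

variable {Ω : Type*} [MeasurableSpace Ω] {P : Measure Ω} [IsProbabilityMeasure P]

lemma integrable_log_gaussianPDFReal {X : Ω → ℝ} (hX : MemLp X 2 P) (b : ℝ) {v : NNReal}
    (hv : v ≠ 0) : Integrable (fun ω => Real.log (gaussianPDFReal b v (X ω))) P := by
  simp only [log_gaussianPDFReal _ hv]
  exact (integrable_const _).sub (((hX.sub (memLp_const b)).integrable_sq).div_const _)

/-- The expected log-density (negative differential entropy) of a normal distribution. -/
lemma integral_log_gaussianPDFReal {X : Ω → ℝ} (hX : MemLp X 2 P) {b : ℝ} {v : NNReal}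
    (hv : v ≠ 0) (hb : ∫ ω, X ω ∂P = b) (hVar : Var[X; P] = v) :
    ∫ ω, Real.log (gaussianPDFReal b v (X ω)) ∂P =
      -(Real.log (2 * Real.pi) + Real.log v) / 2 - 1 / 2 := by
  have hv' : (v : ℝ) ≠ 0 := by positivity
  simp only [log_gaussianPDFReal _ hv]
  have hi : Integrable (fun ω => (X ω - b) ^ 2 / (2 * v)) P :=
    ((hX.sub (memLp_const b)).integrable_sq).div_const _
  have hv2 : ∫ ω, (X ω - b) ^ 2 ∂P = v := by
    rw [← hVar, variance_eq_integral hX.aestronglyMeasurable.aemeasurable, hb]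
  rw [integral_sub (integrable_const _) hi, integral_div (2 * (v : ℝ)), hv2]
  simp
  field_simp

/-- The mutual information of a random vector and its sum with an independent noise, in terms of
the densities of the noise and of the sum. -/
lemma toReal_mutualInfo_add_noise {ι : Type*} [Fintype ι] {X N : Ω → ι → ℝ} (hX : Measurable X)
    (hN : Measurable N) (hXN : IndepFun X N P) {p g : (ι → ℝ) → ℝ} (hp : Measurable p)
    (hg : Measurable g) (hp0 : ∀ x, 0 < p x) (hg0 : ∀ x, 0 < g x)
    (hpN : P.map N = volume.withDensity fun x => ENNReal.ofReal (p x))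
    (hgY : P.map (fun ω => X ω + N ω) = volume.withDensity fun x => ENNReal.ofReal (g x)) :
    (mutualInfo (P.map fun ω => (X ω, X ω + N ω))).toReal =
      ∫ ω, (Real.log (p (N ω)) - Real.log (g (X ω + N ω))) ∂P := by
  have hY : Measurable fun ω => X ω + N ω := hX.add hN
  set ρ := P.map fun ω => (X ω, X ω + N ω) with hρ
  have hfst : ρ.fst = P.map X := by
    rw [hρ, Measure.fst, Measure.map_map measurable_fst (hX.prodMk hY)]; rfl
  have hsnd : ρ.snd = P.map fun ω => X ω + N ω := by
    rw [hρ, Measure.snd, Measure.map_map measurable_snd (hX.prodMk hY)]; rfl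
  have hPX := Measure.isProbabilityMeasure_map (μ := P) hX.aemeasurable
  have hPY := Measure.isProbabilityMeasure_map (μ := P) hY.aemeasurable
  have hPρ := Measure.isProbabilityMeasure_map (μ := P) (hX.prodMk hY).aemeasurable
  rw [← hρ] at hPρ
  set α := P.map X with hα
  -- The conditional density of the sum given the first vector, divided by the marginal density of
  -- the sum.
  set h : (ι → ℝ) × (ι → ℝ) → ENNReal := fun w =>
    ENNReal.ofReal (p (w.2 - w.1) / g w.2) with hh
  have hhm : Measurable h := by fun_prop
  have hprod : α.prod (P.map fun ω => X ω + N ω) =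
      (α.prod volume).withDensity fun w => ENNReal.ofReal (g w.2) := by
    rw [hgY, prod_withDensity_right (by fun_prop)]
  have hdens : ρ = (α.prod (P.map fun ω => X ω + N ω)).withDensity h := by
    have h1 : ρ = (P.map fun ω => (X ω, N ω)).map fun w => (w.1, w.1 + w.2) := by
      rw [Measure.map_map (by fun_prop) (hX.prodMk hN)]; rfl
    rw [h1, (indepFun_iff_map_prod_eq_prod_map_map hX.aemeasurable hN.aemeasurable).1 hXN, hpN,
      prod_withDensity_right (by fun_prop),
      map_withDensity_of_leftInverse (r := fun w => (w.1, w.2 - w.1)) (by fun_prop) (by fun_prop)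
        (by fun_prop) (fun w => by simp), (measurePreserving_prod_add α volume).map_eq, hprod,
      ← withDensity_mul _ (by fun_prop) hhm]
    congr 1
    ext w
    simp only [Function.comp, Pi.mul_apply, hh]
    rw [← ENNReal.ofReal_mul (hg0 _).le, mul_div_cancel₀ _ (hg0 _).ne']
  have hac : ρ ≪ α.prod (P.map fun ω => X ω + N ω) := by
    conv_lhs => rw [hdens]
    exact withDensity_absolutelyContinuous _ _
  have hrn : ρ.rnDeriv (α.prod (P.map fun ω => X ω + N ω)) =ᵐ[ρ] h := by
    refine hac.ae_eq ?_
    conv_lhs => rw [hdens]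
    exact Measure.rnDeriv_withDensity _ hhm
  rw [mutualInfo, hfst, hsnd, InformationTheory.toReal_klDiv_of_measure_eq hac (by simp)]
  have hllr : llr ρ (α.prod (P.map fun ω => X ω + N ω)) =ᵐ[ρ]
      fun w => Real.log (p (w.2 - w.1)) - Real.log (g w.2) := by
    filter_upwards [hrn] with w hw
    rw [llr, hw, hh, ENNReal.toReal_ofReal (div_nonneg (hp0 _).le (hg0 _).le),
      Real.log_div (hp0 _).ne' (hg0 _).ne']
  rw [integral_congr_ae hllr, hρ, integral_map (hX.prodMk hY).aemeasurable
    (Measurable.aestronglyMeasurable (by fun_prop))]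
  simp

end Densities

/-! ### Densities of Gaussian vectors. -/

section Whitening

/-- A positive definite matrix can be whitened. -/
lemma exists_whitening {ι : Type*} [Fintype ι] [DecidableEq ι] {M : Matrix ι ι ℝ}
    (hM : M.PosDef) : ∃ C : Matrix ι ι ℝ, C * M * Cᵀ = 1 := by
  obtain ⟨A, hA⟩ : ∃ A : Matrix ι ι ℝ, M = Aᵀ * A := by
    open scoped MatrixOrder in
    obtain ⟨A, hA⟩ := CStarAlgebra.nonneg_iff_eq_star_mul_self.1 hM.posSemidef.nonneg
    exact ⟨A, by simpa [Matrix.star_eq_conjTranspose] using hA⟩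
  have hdet : IsUnit A.det := by
    have h := (Matrix.isUnit_iff_isUnit_det _).1 hM.isUnit
    rw [hA, Matrix.det_mul] at h
    exact isUnit_of_mul_isUnit_right h
  have hdet' : IsUnit (Aᵀ).det := by rwa [Matrix.det_transpose]
  refine ⟨(Aᵀ)⁻¹, ?_⟩
  rw [hA, ← Matrix.mul_assoc, Matrix.nonsing_inv_mul _ hdet', Matrix.one_mul,
    Matrix.transpose_nonsing_inv, Matrix.transpose_transpose, Matrix.mul_nonsing_inv _ hdet]

variable {Ω : Type*} [MeasurableSpace Ω] {P : Measure Ω} [IsProbabilityMeasure P]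
  {ι : Type*} [Fintype ι] [DecidableEq ι]

lemma covariance_mulVec {Y : ι → Ω → ℝ} (hY : ∀ i, MemLp (Y i) 2 P) {M : Matrix ι ι ℝ}
    (hM : ∀ i j, cov[Y i, Y j; P] = M i j) (C : Matrix ι ι ℝ) (i j : ι) :
    cov[fun ω => (C *ᵥ fun l => Y l ω) i, fun ω => (C *ᵥ fun l => Y l ω) j; P] =
      (C * M * Cᵀ) i j := by
  simp only [Matrix.mulVec, dotProduct]
  rw [covariance_fun_sum_fun_sum (fun l => (hY l).const_mul _) (fun l => (hY l).const_mul _)]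
  simp only [covariance_const_mul_left, covariance_const_mul_right, hM, Matrix.mul_apply,
    Matrix.transpose_apply, Finset.sum_mul]
  rw [Finset.sum_comm]
  refine Finset.sum_congr rfl fun l _ => Finset.sum_congr rfl fun l' _ => ?_
  ring

/-- The density of a Gaussian vector, in terms of a matrix that whitens it. -/
lemma HasGaussianLaw.map_eq_withDensity {Y : ι → Ω → ℝ} (hY : HasGaussianLaw (fun ω i => Y i ω) P)
    {M : Matrix ι ι ℝ} (hM : ∀ i j, cov[Y i, Y j; P] = M i j) {C : Matrix ι ι ℝ}
    (hC : C * M * Cᵀ = 1) :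
    P.map (fun ω i => Y i ω) = volume.withDensity fun y => ENNReal.ofReal (|C.det| *
      ∏ i, gaussianPDFReal (∫ ω, (C *ᵥ fun l => Y l ω) i ∂P) 1 ((C *ᵥ y) i)) := by
  have hL2 : ∀ i, MemLp (Y i) 2 P := fun i => (hY.eval i).memLp_two
  have hCdet : IsUnit C.det := by
    have h := congrArg Matrix.det hC
    rw [Matrix.mul_assoc, Matrix.det_mul, Matrix.det_one] at h
    exact IsUnit.of_mul_eq_one _ h
  have hCi : C * C⁻¹ = 1 := Matrix.mul_nonsing_inv _ hCdet
  have hiC : C⁻¹ * C = 1 := Matrix.nonsing_inv_mul _ hCdet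
  have hW : HasGaussianLaw (fun ω i => (C *ᵥ fun l => Y l ω) i) P :=
    hY.map_fun (Matrix.toLin' C).toContinuousLinearMap
  have hWcov : ∀ i j, cov[fun ω => (C *ᵥ fun l => Y l ω) i, fun ω => (C *ᵥ fun l => Y l ω) j; P] =
      (1 : Matrix ι ι ℝ) i j := fun i j => by rw [covariance_mulVec hL2 hM, hC]
  -- The whitened coordinates are uncorrelated and jointly Gaussian, hence independent with variance
  -- one; undoing the linear map contributes the Jacobian `|C.det|`.
  have hind := hW.iIndepFun_of_covariance_eq_zero fun i j hij => by
    rw [hWcov, Matrix.one_apply_ne hij]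
  have hlaw : P.map (fun ω i => (C *ᵥ fun l => Y l ω) i) = Measure.pi fun i =>
      gaussianReal (∫ ω, (C *ᵥ fun l => Y l ω) i ∂P) 1 := by
    rw [hind.map_fun_eq_pi_map fun i => (hW.eval i).aemeasurable]
    congr 1
    ext1 i
    rw [(hW.eval i).map_eq_gaussianReal, ← covariance_self (hW.eval i).aemeasurable, hWcov]
    simp
  rw [pi_gaussianReal_eq_withDensity _ one_ne_zero] at hlaw
  have hcont : ∀ A : Matrix ι ι ℝ, Measurable (Matrix.toLin' A) := fun A =>
    (Matrix.toLin' A).continuous_of_finiteDimensional.measurable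
  have hYW : P.map (fun ω i => Y i ω) =
      (P.map (fun ω i => (C *ᵥ fun l => Y l ω) i)).map (Matrix.toLin' C⁻¹) := by
    rw [AEMeasurable.map_map_of_aemeasurable (hcont _).aemeasurable hW.aemeasurable]
    congr 1
    ext ω i
    simp [Matrix.mulVec_mulVec, hiC]
  have hpm : Measurable fun x : ι → ℝ => ENNReal.ofReal
      (∏ i, gaussianPDFReal (∫ ω, (C *ᵥ fun l => Y l ω) i ∂P) 1 (x i)) := by
    refine ENNReal.measurable_ofReal.comp (Finset.measurable_prod _ fun i _ => ?_)
    exact (measurable_gaussianPDFReal _ _).comp (measurable_pi_apply i)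
  rw [hYW, hlaw, map_withDensity_of_leftInverse (r := Matrix.toLin' C) hpm (hcont _) (hcont _)
    (fun x => by simp [Matrix.mulVec_mulVec, hCi]),
    Real.map_matrix_volume_pi_eq_smul_volume_pi (by
      rw [Matrix.det_nonsing_inv]; exact hCdet.ringInverse.ne_zero),
    withDensity_smul_measure, ← withDensity_smul _ (hpm.comp (hcont _))]
  congr 1
  ext y
  rw [Pi.smul_apply, smul_eq_mul, Function.comp, ← ENNReal.ofReal_mul (abs_nonneg _)]
  congr 3
  rw [Matrix.det_nonsing_inv, Ring.inverse_eq_inv', inv_inv]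

end Whitening

/-! ### Information gain and predictive variances. -/

section InfoGain

variable {Ω : Type*} [MeasurableSpace Ω] {P : Measure Ω} [IsProbabilityMeasure P]
  {D : Finset Plane} {n : ℕ} {m : D → ℝ} {k : D → D → ℝ} {F : D → Ω → ℝ} {σ : ℝ}
  {x₀ : Ω → Fin n → D} {ε : ℕ → Option (Fin n) → Ω → ℝ}

/-- The information gain of noisy samples of a Gaussian process. -/
lemma toReal_mutualInfo_sampleLaw (hσ : 0 < σ) (hF : IsGP P m k F) (hε : IsNoise P σ F x₀ ε)
    {T : ℕ} (a : Fin T → D) :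
    (mutualInfo (sampleLaw (P.map fun ω q => F q ω) σ a)).toReal =
      (Real.log (noisyGram k σ a).det - T * Real.log (σ ^ 2)) / 2 := by
  set v := Real.toNNReal (σ ^ 2) with hv
  have hv0 : v ≠ 0 := by simpa [hv] using hσ.ne'
  have hvσ : (v : ℝ) = σ ^ 2 := Real.coe_toNNReal _ (sq_nonneg σ)
  -- Mutual information depends only on the joint law, so any `T` distinct noises of the model may
  -- realize the noise vector.
  set e : Fin T → ℕ × Option (Fin n) := fun j => (j, none) with he
  have hinj : Function.Injective e := fun i j h => Fin.ext (Prod.ext_iff.1 h).1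
  set X : Ω → Fin T → ℝ := fun ω j => F (a j) ω with hX
  set N : Ω → Fin T → ℝ := fun ω j => ε (e j).1 (e j).2 ω with hN
  have hFm : Measurable fun ω q => F q ω := measurable_pi_lambda _ hF.measurable
  have hXm : Measurable X := measurable_pi_lambda _ fun j => hF.measurable _
  have hNm : Measurable N := measurable_pi_lambda _ fun j => hε.measurable _ _
  have hNlaw : P.map N = Measure.pi fun _ => gaussianReal 0 v := by
    rw [hN, (hε.iIndep.precomp hinj).map_fun_eq_pi_map fun j => (hε.measurable _ _).aemeasurable]
    simp only [hε.law, hv]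
  have hFN : IndepFun (fun ω q => F q ω) N P := hε.indep_field.comp (φ := id)
    (ψ := fun (w : ℕ × Option (Fin n) → ℝ) j => w (e j)) measurable_id
      (measurable_pi_lambda _ fun i => measurable_pi_apply _)
  have hXN : IndepFun X N P := hFN.comp (φ := fun (f : D → ℝ) j => f (a j)) (ψ := id)
    (measurable_pi_lambda _ fun i => measurable_pi_apply _) measurable_id
  have hlaw : sampleLaw (P.map fun ω q => F q ω) σ a = P.map fun ω => (X ω, X ω + N ω) := by
    rw [sampleLaw, ← hv, ← hNlaw,
      ← (indepFun_iff_map_prod_eq_prod_map_map hFm.aemeasurable hNm.aemeasurable).1 hFN,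
      Measure.map_map (by fun_prop) (hFm.prodMk hNm)]
    rfl
  set Y := noisySample F ε e a with hY
  have hL2 : ∀ i, MemLp (Y i) 2 P := memLp_noisySample hε hF e a
  have hcov : ∀ i j, cov[Y i, Y j; P] = noisyGram k σ a i j := covariance_noisySample hε hF hinj a
  obtain ⟨C, hC⟩ := exists_whitening (posDef_noisyGram hF.posSemidef hσ a)
  have hdet : C.det ^ 2 * (noisyGram k σ a).det = 1 := by
    have h := congrArg Matrix.det hC
    rw [Matrix.det_mul, Matrix.det_mul, Matrix.det_transpose, Matrix.det_one] at h
    linarith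
  have hCdet : 0 < |C.det| := abs_pos.2 fun h => by simp [h] at hdet
  set b : Fin T → ℝ := fun i => ∫ ω, (C *ᵥ fun l => Y l ω) i ∂P with hb
  have hYg : HasGaussianLaw (fun ω i => Y i ω) P := by
    -- The lemma invoked below needs a prediction point, which `a` provides only when `T` is
    -- positive.
    rcases isEmpty_or_nonempty (Fin T) with hT | ⟨⟨j⟩⟩
    · exact HasGaussianLaw.of_subsingleton
    · exact (hasGaussianLaw_predErr_noisySample hε hF hinj a (a j) 0).snd
  have hdensY := HasGaussianLaw.map_eq_withDensity hYg hcov hC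
  have hW2 : ∀ i, MemLp (fun ω => (C *ᵥ fun l => Y l ω) i) 2 P := fun i =>
    memLp_finsetSum Finset.univ fun l _ => (hL2 l).const_mul (C i l)
  have hWvar : ∀ i, Var[fun ω => (C *ᵥ fun l => Y l ω) i; P] = (1 : NNReal) := fun i => by
    rw [← covariance_self (hW2 i).aestronglyMeasurable.aemeasurable, covariance_mulVec hL2 hcov, hC]
    simp
  have hNmean : ∀ j, ∫ ω, N ω j ∂P = 0 := fun j => by
    rw [← integral_map (hε.measurable _ _).aemeasurable (f := fun x => x)
      measurable_id.aestronglyMeasurable, hε.law, integral_id_gaussianReal]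
  have hNvar : ∀ j, Var[fun ω => N ω j; P] = v := fun j => by
    rw [← variance_id_map (hε.measurable _ _).aemeasurable, hε.law, variance_id_gaussianReal]
  have hN2 : ∀ j, MemLp (fun ω => N ω j) 2 P := fun j => hε.memLp _ _
  have hpos : ∀ y : Fin T → ℝ, 0 < ∏ i, gaussianPDFReal (b i) 1 ((C *ᵥ y) i) := fun y =>
    Finset.prod_pos fun i _ => gaussianPDFReal_pos _ _ _ one_ne_zero
  have hcont : Measurable fun y : Fin T → ℝ => C *ᵥ y :=
    (Matrix.toLin' C).continuous_of_finiteDimensional.measurable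
  rw [hlaw, toReal_mutualInfo_add_noise hXm hNm hXN
    (p := fun x => ∏ i, gaussianPDFReal 0 v (x i))
    (g := fun y => |C.det| * ∏ i, gaussianPDFReal (b i) 1 ((C *ᵥ y) i))
    (Finset.measurable_prod _ fun i _ =>
      (measurable_gaussianPDFReal _ _).comp (measurable_pi_apply i))
    ((Finset.measurable_prod _ fun i _ => (measurable_gaussianPDFReal _ _).comp
      ((measurable_pi_apply i).comp hcont)).const_mul _)
    (fun x => Finset.prod_pos fun i _ => gaussianPDFReal_pos _ _ _ hv0)
    (fun y => mul_pos hCdet (hpos y))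
    (by rw [hNlaw, pi_gaussianReal_eq_withDensity _ hv0]) hdensY]
  have h1 : ∀ ω, Real.log (∏ i, gaussianPDFReal 0 v (N ω i)) =
      ∑ i, Real.log (gaussianPDFReal 0 v (N ω i)) := fun ω =>
    Real.log_prod fun i _ => (gaussianPDFReal_pos _ _ _ hv0).ne'
  have h2 : ∀ ω, Real.log (|C.det| * ∏ i, gaussianPDFReal (b i) 1 ((C *ᵥ (X ω + N ω)) i)) =
      Real.log |C.det| +
        ∑ i, Real.log (gaussianPDFReal (b i) 1 ((C *ᵥ fun l => Y l ω) i)) := fun ω => by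
    rw [Real.log_mul hCdet.ne' (hpos _).ne',
      Real.log_prod fun i _ => (gaussianPDFReal_pos _ _ _ one_ne_zero).ne']
    rfl
  simp only [h1, h2]
  have hi1 : ∀ i ∈ Finset.univ, Integrable (fun ω => Real.log (gaussianPDFReal 0 v (N ω i))) P :=
    fun i _ => integrable_log_gaussianPDFReal (hN2 i) _ hv0
  have hi2 : ∀ i ∈ Finset.univ, Integrable (fun ω =>
      Real.log (gaussianPDFReal (b i) 1 ((C *ᵥ fun l => Y l ω) i))) P :=
    fun i _ => integrable_log_gaussianPDFReal (hW2 i) _ one_ne_zero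
  have hi3 : Integrable (fun ω => Real.log |C.det| +
      ∑ i, Real.log (gaussianPDFReal (b i) 1 ((C *ᵥ fun l => Y l ω) i))) P :=
    (integrable_const _).add (integrable_finsetSum _ hi2)
  rw [integral_sub (integrable_finsetSum _ hi1) hi3,
    integral_add (integrable_const _) (integrable_finsetSum _ hi2), integral_finsetSum _ hi1,
    integral_finsetSum _ hi2]
  have hent : ∀ i, ∫ ω, Real.log (gaussianPDFReal (b i) 1 ((C *ᵥ fun l => Y l ω) i)) ∂P =
      -(Real.log (2 * Real.pi) + Real.log (1 : NNReal)) / 2 - 1 / 2 := fun i =>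
    integral_log_gaussianPDFReal (hW2 i) one_ne_zero rfl (hWvar i)
  simp only [integral_log_gaussianPDFReal (hN2 _) hv0 (hNmean _) (hNvar _), hent]
  -- The expected log-densities are constants whose `2π` and `1 / 2` parts cancel; the determinant
  -- enters only through the Jacobian of the whitening.
  have hlogdet : Real.log (noisyGram k σ a).det = -2 * Real.log |C.det| := by
    have hM : 0 < (noisyGram k σ a).det := (posDef_noisyGram hF.posSemidef hσ a).det_pos
    have h := congrArg Real.log hdet
    rw [Real.log_mul (pow_ne_zero 2 (abs_pos.1 hCdet)) hM.ne', Real.log_one, Real.log_pow, ← Real.log_abs] at h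
    push_cast at h
    linarith
  rw [hlogdet, hvσ]
  simp
  ring

/-- It is the variance of a prediction error; `e` only supplies noises to realize that error. -/
lemma krigVar_nonneg (hσ : 0 < σ) (hF : IsGP P m k F) (hε : IsNoise P σ F x₀ ε) {ι : Type*}
    [Fintype ι] [DecidableEq ι] {e : ι → ℕ × Option (Fin n)} (he : Function.Injective e)
    (z : ι → D) (q : D) : 0 ≤ krigVar k σ z q := by
  rw [← variance_predErr hσ hε hF he]
  exact variance_nonneg _ _

/-- The maximum information gain bounds the sum of the logarithms of the normalized predictive
variances along any sequence of locations. -/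
lemma sum_log_le_maxInfoGain (hσ : 0 < σ) (hF : IsGP P m k F) (hε : IsNoise P σ F x₀ ε) (T : ℕ)
    (a : ℕ → D) :
    (∑ j ∈ Finset.range T, Real.log (1 + krigVar k σ (fun i : Fin j => a i) (a j) / σ ^ 2)) / 2 ≤
      maxInfoGain (P.map fun ω q => F q ω) σ T := by
  have hσ2 : 0 < σ ^ 2 := by positivity
  have hnn : ∀ j, 0 ≤ krigVar k σ (fun i : Fin j => a i) (a j) := fun j =>
    krigVar_nonneg hσ hF hε (e := fun i : Fin j => ((i : ℕ), (none : Option (Fin n))))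
      (fun i i' h => Fin.ext (Prod.ext_iff.1 h).1) _ _
  have h := toReal_mutualInfo_sampleLaw hσ hF hε fun i : Fin T => a i
  rw [det_noisyGram hF.posSemidef hσ a,
    Real.log_prod fun j _ => by have := hnn j; positivity] at h
  have hsum : ∑ j ∈ Finset.range T, Real.log (1 + krigVar k σ (fun i : Fin j => a i) (a j) / σ ^ 2)
      = ∑ j ∈ Finset.range T, Real.log (σ ^ 2 + krigVar k σ (fun i : Fin j => a i) (a j)) -
        T * Real.log (σ ^ 2) := by
    have hc : (T : ℝ) * Real.log (σ ^ 2) = ∑ _j ∈ Finset.range T, Real.log (σ ^ 2) := by simp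
    rw [hc, ← Finset.sum_sub_distrib]
    refine Finset.sum_congr rfl fun j _ => ?_
    rw [← Real.log_div (by have := hnn j; positivity) hσ2.ne', add_div, div_self hσ2.ne']
  rw [hsum, ← h]
  exact le_ciSup (f := fun a : Fin T → D =>
    (mutualInfo (sampleLaw (P.map fun ω q => F q ω) σ a)).toReal) (Set.finite_range _).bddAbove _

end InfoGain

/-! ### Sensitivity of the coverage cost. -/

section Coverage

variable {D : Finset Plane} {n : ℕ}

lemma region_injective (x : Fin n → D) (q : D) {i j : Fin n} (hi : q ∈ region x i)
    (hj : q ∈ region x j) : i = j := by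
  rcases lt_trichotomy i j with h | h | h
  · exact absurd hi.1 (hj.2 i h)
  · exact h
  · exact absurd hj.1 (hi.2 j h)

lemma cost_mono {f g : D → ℝ} (h : ∀ q, f q ≤ g q) (x : Fin n → D) : cost f x ≤ cost g x := by
  unfold cost
  refine Finset.sum_le_sum fun i _ => Finset.sum_le_sum fun q _ => ?_
  split_ifs
  · exact mul_le_mul_of_nonneg_left (h q) (sq_nonneg _)
  · exact le_rfl

/-- Tie-breaking puts each point into at most one region, so raising the density by `B` costs at
most `M * B` per point, whatever the number of robots. -/
lemma cost_le_cost_add {f g : D → ℝ} {M B : ℝ} (hM : ∀ q q' : D, ‖(q : Plane) - q'‖ ^ 2 ≤ M)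
    (hB : 0 ≤ B) (h : ∀ q, g q ≤ f q + B) (x : Fin n → D) :
    cost g x ≤ cost f x + D.card * (M * B) := by
  classical
  have h1 : cost g x ≤ cost f x +
      ∑ i, ∑ q : D, if q ∈ region x i then M * B else 0 := by
    unfold cost
    rw [← Finset.sum_add_distrib]
    refine Finset.sum_le_sum fun i _ => ?_
    rw [← Finset.sum_add_distrib]
    refine Finset.sum_le_sum fun q _ => ?_
    split_ifs
    · nlinarith [mul_le_mul_of_nonneg_left (h q) (sq_nonneg ‖(q : Plane) - x i‖),
        mul_le_mul_of_nonneg_right (hM q (x i)) hB]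
    · simp
  refine h1.trans (add_le_add_right ?_ _)
  rw [Finset.sum_comm]
  refine (Finset.sum_le_card_nsmul _ _ (M * B) fun q _ => ?_).trans_eq (by simp)
  have hMB : 0 ≤ M * B := mul_nonneg ((sq_nonneg _).trans (hM q q)) hB
  by_cases hq : ∃ i, q ∈ region x i
  · obtain ⟨i, hi⟩ := hq
    rw [Finset.sum_eq_single i (fun j _ hj => if_neg fun hj' => hj (region_injective x q hj' hi))
      (by simp), if_pos hi]
  · push Not at hq
    rw [Finset.sum_eq_zero fun i _ => if_neg (hq i)]
    exact hMB

lemma regret_nonneg (f : D → ℝ) (x : Fin n → D) : 0 ≤ regret f x :=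
  sub_nonneg.2 (ciInf_le (Set.finite_range _).bddBelow x)

/-- The regret of a minimizer of the cost of a lower bound of the density. -/
lemma regret_le {f g : D → ℝ} {M B : ℝ} (hM : ∀ q q' : D, ‖(q : Plane) - q'‖ ^ 2 ≤ M)
    (hB : 0 ≤ B) (hgf : ∀ q, g q ≤ f q) (hfg : ∀ q, f q ≤ g q + B) {x : Fin n → D}
    (hx : ∀ x' : Fin n → D, cost g x ≤ cost g x') : regret f x ≤ D.card * (M * B) := by
  have : Nonempty (Fin n → D) := ⟨x⟩
  rw [regret, sub_le_comm]
  refine le_ciInf fun x' => ?_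
  -- Up to the additive error, the cost of `x` for `f` is at most that for `g`, hence at most the
  -- cost of `x'` for `g`, hence at most that for `f`.
  linarith [cost_le_cost_add hM hB hfg x, hx x', cost_mono hgf x']

lemma cumRegret_eq_sum_range (f : D → ℝ) (x : ℕ → Fin n → D) (T : ℕ) :
    cumRegret f x T = ∑ j ∈ Finset.range T, regret f (x (j + 1)) := by
  rw [cumRegret, ← Finset.Ico_add_one_right_eq_Icc, Finset.sum_Ico_eq_sum_range]
  simp [add_comm]

end Coverage

/-! ### The confidence parameter. -/

section Beta

lemma one_lt_beta_arg {D : Finset Plane} (hD : 0 < D.card) {δ : ℝ} (hδ : 0 < δ) (hδ' : δ ≤ 1)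
    {t : ℕ} (ht : 1 ≤ t) :
    1 ≤ (D.card : ℝ) * ((t : ℝ) ^ 2 * Real.pi ^ 2 / (6 * δ)) := by
  have h1 : (1 : ℝ) ≤ D.card := by exact_mod_cast hD
  have h2 : (1 : ℝ) ≤ (t : ℝ) ^ 2 := one_le_pow₀ (by exact_mod_cast ht)
  have h3 : (1 : ℝ) ≤ (t : ℝ) ^ 2 * Real.pi ^ 2 / (6 * δ) := by
    rw [le_div_iff₀ (by positivity)]
    nlinarith [Real.pi_gt_three, sq_nonneg (Real.pi - 3)]
  nlinarith

lemma beta_nonneg {D : Finset Plane} (hD : 0 < D.card) {δ : ℝ} (hδ : 0 < δ) (hδ' : δ ≤ 1)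
    {t : ℕ} (ht : 1 ≤ t) : 0 ≤ beta D δ t :=
  mul_nonneg zero_le_two (Real.log_nonneg (one_lt_beta_arg hD hδ hδ' ht))

lemma beta_mono {D : Finset Plane} (hD : 0 < D.card) {δ : ℝ} (hδ : 0 < δ) (hδ' : δ ≤ 1)
    {s t : ℕ} (hs : 1 ≤ s) (hst : s ≤ t) : beta D δ s ≤ beta D δ t := by
  have h := one_lt_beta_arg hD hδ hδ' hs
  unfold beta
  gcongr

/-- The failure budget of one point at time `t`: summed over the points and then over `t`, it gives
exactly `δ`. -/
lemma exp_neg_beta_div_two {D : Finset Plane} (hD : 0 < D.card) {δ : ℝ} (hδ : 0 < δ)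
    {t : ℕ} (ht : 1 ≤ t) :
    Real.exp (-beta D δ t / 2) = 6 * δ / Real.pi ^ 2 * (1 / (t : ℝ) ^ 2) / D.card := by
  have hD' : (0 : ℝ) < D.card := by exact_mod_cast hD
  have ht' : (0 : ℝ) < t := by exact_mod_cast ht
  have hpi := Real.pi_pos
  rw [beta, neg_div, mul_div_cancel_left₀ _ (two_ne_zero' ℝ), Real.exp_neg,
    Real.exp_log (by positivity)]
  field_simp

lemma tendsto_beta_div {D : Finset Plane} (hD : 0 < D.card) {δ : ℝ} (hδ : 0 < δ) :
    Tendsto (fun t : ℕ => beta D δ t / t) atTop (𝓝 0) := by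
  have hD' : (0 : ℝ) < D.card := by exact_mod_cast hD
  have hpi := Real.pi_pos
  have h1 : Tendsto (fun t : ℕ => Real.log t / t) atTop (𝓝 0) :=
    (Real.isLittleO_log_id_atTop.tendsto_div_nhds_zero).comp tendsto_natCast_atTop_atTop
  have h2 : Tendsto (fun t : ℕ => 2 * Real.log (D.card * (Real.pi ^ 2 / (6 * δ))) / t) atTop
      (𝓝 0) := tendsto_const_div_atTop_nhds_zero_nat _
  have h3 := h2.add (h1.const_mul 4)
  simp only [mul_zero, add_zero] at h3
  refine h3.congr' ?_
  filter_upwards [eventually_ge_atTop 1] with t ht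
  have ht' : (0 : ℝ) < t := by exact_mod_cast ht
  have : (D.card : ℝ) * ((t : ℝ) ^ 2 * Real.pi ^ 2 / (6 * δ)) =
      D.card * (Real.pi ^ 2 / (6 * δ)) * t ^ 2 := by ring
  rw [beta, this, Real.log_mul (y := (t : ℝ) ^ 2) (by positivity) (by positivity), Real.log_pow]
  push_cast
  ring

end Beta

/-! ### Decay of variances and elementary bounds. -/

section Deterministic

variable {D : Finset Plane} {n : ℕ} {k : D → D → ℝ} {σ : ℝ}

lemma gpVar_anti (hk : (Matrix.of k).PosSemidef) (hσ : 0 < σ) (z : ℕ → Option (Fin n) → D)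
    {s t : ℕ} (hst : s ≤ t) (q : D) : gpVar k σ z t q ≤ gpVar k σ z s q :=
  krigVar_le_comp hk hσ (sampled z t)
    (fun a : DataIdx n s => ((Fin.castLE hst a.1, a.2) : DataIdx n t)) (by
      rintro ⟨i, o⟩ ⟨j, o'⟩ h
      rw [Prod.mk.injEq] at h
      exact Prod.ext (Fin.castLE_injective hst h.1) h.2) q

/-- Forgetting the robots' own samples leaves one location per time, hence an information gain of
only `T` samples. -/
lemma gpVar_le_krigVar_none (hk : (Matrix.of k).PosSemidef) (hσ : 0 < σ)
    (z : ℕ → Option (Fin n) → D) (t : ℕ) (q : D) :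
    gpVar k σ z t q ≤ krigVar k σ (fun i : Fin t => z (i + 1) none) q :=
  krigVar_le_comp hk hσ (sampled z t) (fun i : Fin t => ((i, none) : DataIdx n t))
    (fun _ _ h => (Prod.mk.inj h).1) q

/-- Under maximum variance sampling, the maximum of the posterior variance decays. -/
lemma gpVar_le_of_greedy (hk : (Matrix.of k).PosSemidef) (hσ : 0 < σ)
    (z : ℕ → Option (Fin n) → D)
    (hz : ∀ t q, gpVar k σ z t q ≤ gpVar k σ z t (z (t + 1) none)) {K t : ℕ} (hK : 0 < K)
    (hKt : D.card * K < t) (q : D) : gpVar k σ z t q ≤ σ ^ 2 / K := by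
  classical
  -- By pigeonhole some `p` is chosen more than `K` times. At its last choice `l` it has been
  -- sampled `K` times already and still maximizes the variance, so its small variance bounds all
  -- others.
  obtain ⟨p, -, hp⟩ := Finset.exists_lt_card_fiber_of_mul_lt_card_of_maps_to
    (s := Finset.range t) (t := (Finset.univ : Finset D)) (f := fun j => z (j + 1) none) (n := K)
    (fun _ _ => Finset.mem_univ _) (by simpa using hKt)
  set S := {j ∈ Finset.range t | z (j + 1) none = p} with hS
  have hSne : S.Nonempty := Finset.card_pos.1 (by omega)
  set l := S.max' hSne with hl
  have hlS : l ∈ S := S.max'_mem hSne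
  have hlt : l < t := Finset.mem_range.1 (Finset.mem_filter.1 hlS).1
  have hlp : z (l + 1) none = p := (Finset.mem_filter.1 hlS).2
  have hcard : K ≤ (S.erase l).card := by rw [Finset.card_erase_of_mem hlS]; omega
  obtain ⟨S', hS', hS'K⟩ := Finset.exists_subset_card_eq hcard
  have hlt' : ∀ j ∈ S', j < l := fun j hj => by
    have h := Finset.mem_erase.1 (hS' hj)
    exact lt_of_le_of_ne (S.le_max' j h.2) h.1
  let e : Fin K → DataIdx n l := fun j =>
    (⟨S'.orderEmbOfFin hS'K j, hlt' _ (S'.orderEmbOfFin_mem hS'K j)⟩, none)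
  calc gpVar k σ z t q ≤ gpVar k σ z l q := gpVar_anti hk hσ z hlt.le q
    _ ≤ gpVar k σ z l p := hlp ▸ hz l q
    _ ≤ σ ^ 2 / K := by
      refine krigVar_le_div_of_repeated hk hσ (sampled z l) p hK e (fun i j h => ?_) fun j => ?_
      · have h' := congrArg (fun w : DataIdx n l => (w.1 : ℕ)) h
        exact (S'.orderEmbOfFin hS'K).injective h'
      · have h := Finset.mem_erase.1 (hS' (S'.orderEmbOfFin_mem hS'K j))
        exact (Finset.mem_filter.1 h.2).2

/-- Bernoulli's inequality `(1 + c) ^ v ≤ 1 + v * c` for exponents in `[0, 1]`; it turns variances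
into information. -/
lemma mul_log_one_add_le {v c : ℝ} (hv : 0 ≤ v) (hv' : v ≤ 1) (hc : 0 < c) :
    v * Real.log (1 + c) ≤ Real.log (1 + v * c) := by
  rw [← Real.log_rpow (by positivity)]
  exact Real.log_le_log (by positivity)
    (rpow_one_add_le_one_add_mul_self (by linarith) hv hv')

/-- A bound on the squared distances in terms of which `constOne` is expressed. -/
lemma exists_sq_dist_bound (D : Finset Plane) (hσ : 0 < σ) :
    ∃ M : ℝ, 0 ≤ M ∧ (∀ q q' : D, ‖(q : Plane) - q'‖ ^ 2 ≤ M) ∧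
      constOne D σ * Real.log (1 + (σ ^ 2)⁻¹) = 8 * (D.card : ℝ) ^ 2 * M ^ 2 := by
  have hlog : 0 < Real.log (1 + (σ ^ 2)⁻¹) := Real.log_pos (by
    have : 0 < (σ ^ 2)⁻¹ := by positivity
    linarith)
  set L := ⨆ w : D × D, ‖(w.1 : Plane) - w.2‖ ^ 4 / Real.log (1 + (σ ^ 2)⁻¹) with hL
  have hle : ∀ w : D × D, ‖(w.1 : Plane) - w.2‖ ^ 4 / Real.log (1 + (σ ^ 2)⁻¹) ≤ L := fun w =>
    le_ciSup (f := fun w : D × D => ‖(w.1 : Plane) - w.2‖ ^ 4 / Real.log (1 + (σ ^ 2)⁻¹))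
      (Set.finite_range _).bddAbove w
  have hL0 : 0 ≤ L := Real.iSup_nonneg fun w => by positivity
  -- Chosen so that `M ^ 2` undoes the normalization by the logarithm without moving the division
  -- out of the supremum.
  refine ⟨√(L * Real.log (1 + (σ ^ 2)⁻¹)), Real.sqrt_nonneg _, fun q q' => ?_, ?_⟩
  · refine Real.le_sqrt_of_sq_le ?_
    rw [← pow_mul]
    exact (div_le_iff₀ hlog).1 (hle (q, q'))
  · rw [Real.sq_sqrt (by positivity), constOne, ← hL]
    ring

end Deterministic

/-! ### Regret of a calibrated run. -/

section Run

variable {Ω : Type*} [MeasurableSpace Ω] {P : Measure Ω} [IsProbabilityMeasure P]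
  {D : Finset Plane} {n : ℕ} {m : D → ℝ} {k : D → D → ℝ} {F : D → Ω → ℝ} {σ δ : ℝ}
  {E : Estimator} {x : ℕ → Ω → Fin n → D} {xt : ℕ → Ω → D} {ε : ℕ → Option (Fin n) → Ω → ℝ}

/-- All confidence intervals of a run contain the field. -/
def IsCalibrated (m : D → ℝ) (k : D → D → ℝ) (σ δ : ℝ) (F : D → Ω → ℝ)
    (ε : ℕ → Option (Fin n) → Ω → ℝ) (x : ℕ → Ω → Fin n → D) (xt : ℕ → Ω → D) (ω : Ω) : Prop :=
  ∀ (t : ℕ) (q : D), |F q ω - gpMean m k σ (sites (fun s => x s ω) (fun s => xt s ω))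
      (fun s o => measurement F ε x xt s o ω) t q| ≤
    √(beta D δ (t + 1)) * √(gpVar k σ (sites (fun s => x s ω) (fun s => xt s ω)) t q)

/-- A union bound over points and times. The posterior after time `t` guides the choice at time `t +
1`, hence the index of `beta` and the shifted Basel series. -/
lemma measure_not_isCalibrated_le (hσ : 0 < σ) (hδ : 0 < δ) (hδ' : δ ≤ 1) (hD : 0 < D.card)
    (hF : IsGP P m k F) (hε : IsNoise P σ F (x 0) ε) (hrun : IsRun E m k σ δ F ε x xt) :
    P {ω | ¬ IsCalibrated m k σ δ F ε x xt ω} ≤ ENNReal.ofReal δ := by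
  have hD' : (0 : ℝ) < D.card := by exact_mod_cast hD
  have hpi := Real.pi_pos
  set bad : ℕ → D → Set Ω := fun t q =>
    {ω | √(beta D δ (t + 1)) * √(gpVar k σ (sites (fun s => x s ω) (fun s => xt s ω)) t q) <
      |F q ω - gpMean m k σ (sites (fun s => x s ω) (fun s => xt s ω))
        (fun s o => measurement F ε x xt s o ω) t q|} with hbad
  have hsites : ∀ t, 1 ≤ t → ∀ o, Measurable[history (x 0) (measurement F ε x xt) t]
      (fun ω => sites (fun s => x s ω) (fun s => xt s ω) t o) := by
    intro t ht o
    cases o with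
    | some i => exact (measurable_pi_apply i).comp (hrun.adapted_control t ht)
    | none => exact hrun.adapted_sample t ht
  have hone : ∀ t q, P (bad t q) ≤
      ENNReal.ofReal (6 * δ / Real.pi ^ 2 * (1 / ((t : ℝ) + 1) ^ 2) / D.card) := fun t q => by
    have h := measure_lt_abs_sub_gpMean_le hσ hF hε
      (Z := fun t o ω => sites (fun s => x s ω) (fun s => xt s ω) t o)
      (Y := measurement F ε x xt) (fun _ _ _ => rfl) hsites t q
      (beta_nonneg hD hδ hδ' (Nat.le_add_left 1 t))
    rw [exp_neg_beta_div_two hD hδ (Nat.le_add_left 1 t)] at h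
    push_cast at h
    exact h
  have hsum : HasSum (fun t : ℕ => 6 * δ / Real.pi ^ 2 * (1 / ((t : ℝ) + 1) ^ 2)) δ := by
    have h := (hasSum_nat_add_iff' 1).2 hasSum_zeta_two
    simp only [Finset.range_one, Finset.sum_singleton, Nat.cast_zero, ne_eq, OfNat.ofNat_ne_zero,
      not_false_eq_true, zero_pow, div_zero, sub_zero, Nat.cast_add, Nat.cast_one] at h
    have h' : 6 * δ / Real.pi ^ 2 * (Real.pi ^ 2 / 6) = δ := by field_simp
    have h2 := h.mul_left (6 * δ / Real.pi ^ 2)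
    rw [h'] at h2
    exact h2
  calc P {ω | ¬ IsCalibrated m k σ δ F ε x xt ω} ≤ P (⋃ t, ⋃ q, bad t q) := by
        refine measure_mono fun ω hω => ?_
        simp only [IsCalibrated, Set.mem_ofPred_eq] at hω
        push Not at hω
        obtain ⟨t, q, h⟩ := hω
        exact Set.mem_iUnion₂.2 ⟨t, q, h⟩
    _ ≤ ∑' t, P (⋃ q, bad t q) := measure_iUnion_le _
    _ ≤ ∑' t : ℕ, ENNReal.ofReal (6 * δ / Real.pi ^ 2 * (1 / ((t : ℝ) + 1) ^ 2)) := by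
        refine ENNReal.tsum_le_tsum fun t => ?_
        refine (measure_iUnion_fintype_le _ _).trans
          ((Finset.sum_le_sum fun q _ => hone t q).trans_eq ?_)
        rw [Finset.sum_const, nsmul_eq_mul, ← ENNReal.ofReal_natCast,
          ← ENNReal.ofReal_mul (Nat.cast_nonneg _)]
        congr 1
        simp only [Finset.card_univ, Fintype.card_coe]
        field_simp
    _ = ENNReal.ofReal δ := by
        rw [← ENNReal.ofReal_tsum_of_nonneg (fun t => by positivity) hsum.summable, hsum.tsum_eq]

/-- The regret of one step of a calibrated run. -/
lemma regret_le_of_isCalibrated (hσ : 0 < σ) (hE : E.HasPrior m k)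
    (hrun : IsRun E m k σ δ F ε x xt) {M : ℝ} (hM : ∀ q q' : D, ‖(q : Plane) - q'‖ ^ 2 ≤ M) {ω : Ω}
    (hω : IsCalibrated m k σ δ F ε x xt ω) (t : ℕ) :
    regret (fun q => F q ω) (x (t + 1) ω) ≤ D.card * (M * (2 * (√(beta D δ (t + 1)) *
      √(gpVar k σ (sites (fun s => x s ω) (fun s => xt s ω)) t (xt (t + 1) ω))))) := by
  have hc := hrun.control (t + 1) (Nat.le_add_left 1 t) ω
  have hs := hrun.sample (t + 1) (Nat.le_add_left 1 t) ω
  simp only [Estimator.mean_eq_gpMean hσ hE, Estimator.sd_eq_gpVar hσ hE,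
    Nat.add_sub_cancel] at hc hs
  -- The surrogate is the lower confidence bound, so the gap to the field is at most the full width
  -- of the interval, which is largest at the additional location.
  refine regret_le hM (by positivity) (fun q => ?_) (fun q => ?_) hc
  · have := (abs_le.1 (hω t q)).1
    linarith
  · have h1 := (abs_le.1 (hω t q)).2
    have h2 := mul_le_mul_of_nonneg_left (hs q) (Real.sqrt_nonneg (beta D δ (t + 1)))
    linarith

lemma gpVar_le_gpVar_sample (hσ : 0 < σ) (hF : IsGP P m k F) (hε : IsNoise P σ F (x 0) ε)
    (hE : E.HasPrior m k) (hrun : IsRun E m k σ δ F ε x xt) (ω : Ω) (t : ℕ) (q : D) :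
    gpVar k σ (sites (fun s => x s ω) (fun s => xt s ω)) t q ≤
      gpVar k σ (sites (fun s => x s ω) (fun s => xt s ω)) t (xt (t + 1) ω) := by
  have hs := hrun.sample (t + 1) (Nat.le_add_left 1 t) ω
  simp only [Estimator.sd_eq_gpVar hσ hE, Nat.add_sub_cancel] at hs
  refine (Real.sqrt_le_sqrt_iff ?_).1 (hs q)
  rw [gpVar_eq_krigVar]
  exact krigVar_nonneg hσ hF hε (noiseIdx_injective n t) _ _

lemma cumRegret_le_of_isCalibrated (hσ : 0 < σ) (hδ : 0 < δ) (hδ' : δ ≤ 1) (hD : 0 < D.card)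
    (hk : ∀ q q', k q q' ≤ 1) (hF : IsGP P m k F) (hε : IsNoise P σ F (x 0) ε)
    (hE : E.HasPrior m k) (hrun : IsRun E m k σ δ F ε x xt) {ω : Ω}
    (hω : IsCalibrated m k σ δ F ε x xt ω) {T : ℕ} (hT : 1 ≤ T) :
    cumRegret (fun q => F q ω) (fun t => x t ω) T ≤
      √(constOne D σ * (n + 1) * T * beta D δ T * maxInfoGain (P.map fun ω q => F q ω) σ T) := by
  obtain ⟨M, hM0, hM, hMc⟩ := exists_sq_dist_bound D hσ
  have hσ2 : 0 < (σ ^ 2)⁻¹ := by positivity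
  have hlog : 0 < Real.log (1 + (σ ^ 2)⁻¹) := Real.log_pos (by linarith)
  have hβT := beta_nonneg hD hδ hδ' hT
  set z := sites (fun s => x s ω) (fun s => xt s ω) with hz
  set s : ℕ → ℝ := fun j => gpVar k σ z j (xt (j + 1) ω) with hs
  -- Variances given only the earlier additional samples: these are the factors in the determinant
  -- formula. Together with `hk`, they stay in the range of Bernoulli's inequality.
  set w : ℕ → ℝ := fun j => krigVar k σ (fun i : Fin j => xt (i + 1) ω) (xt (j + 1) ω) with hw
  set G := maxInfoGain (P.map fun ω q => F q ω) σ T with hG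
  have hs0 : ∀ j, 0 ≤ s j := fun j => by
    rw [hs]
    simp only [gpVar_eq_krigVar]
    exact krigVar_nonneg hσ hF hε (noiseIdx_injective n j) _ _
  have hsw : ∀ j, s j ≤ w j := fun j => gpVar_le_krigVar_none hF.posSemidef hσ z j _
  have hw1 : ∀ j, w j ≤ 1 := fun j => (krigVar_le_prior hF.posSemidef hσ _ _).trans (hk _ _)
  have hgain : (∑ j ∈ Finset.range T, Real.log (1 + w j / σ ^ 2)) / 2 ≤ G :=
    sum_log_le_maxInfoGain hσ hF hε T fun j => xt (j + 1) ω
  have hsum : Real.log (1 + (σ ^ 2)⁻¹) * ∑ j ∈ Finset.range T, s j ≤ 2 * G := by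
    refine le_trans ?_ (by linarith :
      ∑ j ∈ Finset.range T, Real.log (1 + w j / σ ^ 2) ≤ 2 * G)
    rw [Finset.mul_sum]
    refine Finset.sum_le_sum fun j _ => ?_
    calc Real.log (1 + (σ ^ 2)⁻¹) * s j ≤ Real.log (1 + (σ ^ 2)⁻¹) * w j :=
          mul_le_mul_of_nonneg_left (hsw j) hlog.le
      _ ≤ Real.log (1 + w j / σ ^ 2) := by
          rw [mul_comm, div_eq_mul_inv]
          exact mul_log_one_add_le ((hs0 j).trans (hsw j)) (hw1 j) hσ2
  have hG0 : 0 ≤ G := by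
    have := mul_nonneg hlog.le (Finset.sum_nonneg fun j (_ : j ∈ Finset.range T) => hs0 j)
    linarith
  have hstep : ∀ j ∈ Finset.range T, regret (fun q => F q ω) (x (j + 1) ω) ^ 2 ≤
      4 * (D.card : ℝ) ^ 2 * M ^ 2 * beta D δ T * s j := fun j hj => by
    have hβ0 := beta_nonneg hD hδ hδ' (Nat.le_add_left 1 j)
    have hβ := beta_mono hD hδ hδ' (Nat.le_add_left 1 j)
      (Nat.succ_le_of_lt (Finset.mem_range.1 hj))
    refine (pow_le_pow_left₀ (regret_nonneg _ _)
      (regret_le_of_isCalibrated hσ hE hrun hM hω j) 2).trans ?_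
    rw [mul_pow, mul_pow, mul_pow, mul_pow, Real.sq_sqrt hβ0, Real.sq_sqrt (hs0 j)]
    have h := mul_le_mul_of_nonneg_right hβ (hs0 j)
    have h' := mul_le_mul_of_nonneg_left h (by positivity : 0 ≤ 4 * (D.card : ℝ) ^ 2 * M ^ 2)
    linarith
  have hc1 : 0 ≤ constOne D σ := by
    have : 0 ≤ constOne D σ * Real.log (1 + (σ ^ 2)⁻¹) := by rw [hMc]; positivity
    exact nonneg_of_mul_nonneg_left this hlog
  refine Real.le_sqrt_of_sq_le ?_
  rw [cumRegret_eq_sum_range]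
  calc (∑ j ∈ Finset.range T, regret (fun q => F q ω) (x (j + 1) ω)) ^ 2
      ≤ T * ∑ j ∈ Finset.range T, regret (fun q => F q ω) (x (j + 1) ω) ^ 2 := by
        simpa using sq_sum_le_card_mul_sum_sq (s := Finset.range T)
          (f := fun j => regret (fun q => F q ω) (x (j + 1) ω))
    _ ≤ T * ∑ j ∈ Finset.range T, 4 * (D.card : ℝ) ^ 2 * M ^ 2 * beta D δ T * s j := by
        gcongr with j hj
        exact hstep j hj
    -- By the choice of `M`, `4 |D|² M²` is half of `constOne` times the logarithm.
    _ = constOne D σ * T * beta D δ T *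
        (Real.log (1 + (σ ^ 2)⁻¹) * ∑ j ∈ Finset.range T, s j) / 2 := by
        rw [← Finset.mul_sum]
        linear_combination (-(T * beta D δ T * ∑ j ∈ Finset.range T, s j) / 2) * hMc
    _ ≤ constOne D σ * T * beta D δ T * (2 * G) / 2 := by gcongr
    -- The estimate holds with `1` in place of `n + 1`; the last step relaxes it.
    _ = constOne D σ * 1 * T * beta D δ T * G := by ring
    _ ≤ constOne D σ * (n + 1) * T * beta D δ T * G := by
        gcongr
        linarith [(Nat.cast_nonneg n : (0 : ℝ) ≤ n)]

/-- The maximal variance is of order `1 / t` and `β_t` of order `log t`, so the bound on a single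
step vanishes. -/
lemma tendsto_regret_of_isCalibrated (hσ : 0 < σ) (hδ : 0 < δ) (hδ' : δ ≤ 1) (hD : 0 < D.card)
    (hF : IsGP P m k F) (hε : IsNoise P σ F (x 0) ε)
    (hE : E.HasPrior m k) (hrun : IsRun E m k σ δ F ε x xt) {ω : Ω}
    (hω : IsCalibrated m k σ δ F ε x xt ω) :
    Tendsto (fun j => regret (fun q => F q ω) (x (j + 1) ω)) atTop (𝓝 0) := by
  obtain ⟨M, hM0, hM, -⟩ := exists_sq_dist_bound D hσ
  have hD' : (0 : ℝ) < D.card := by exact_mod_cast hD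
  have hlim : Tendsto (fun j : ℕ => D.card * (M * (2 * √(3 * D.card * σ ^ 2 *
      (beta D δ (j + 1) / (j + 1 : ℕ)))))) atTop (𝓝 0) := by
    have h1 := ((tendsto_beta_div hD hδ).comp (tendsto_add_atTop_nat 1)).const_mul
      (3 * D.card * σ ^ 2)
    have h2 := ((((Real.continuous_sqrt.tendsto _).comp h1).const_mul 2).const_mul M).const_mul
      (D.card : ℝ)
    simpa [Function.comp_def] using h2
  refine squeeze_zero' (Eventually.of_forall fun j => regret_nonneg _ _) ?_ hlim
  filter_upwards [eventually_ge_atTop (2 * D.card + 1)] with j hj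
  refine (regret_le_of_isCalibrated hσ hE hrun hM hω j).trans ?_
  have hβ0 := beta_nonneg hD hδ hδ' (Nat.le_add_left 1 j)
  -- A number of guaranteed repetitions: `j - 1` makes `D.card * K < j` strict, and rounding down
  -- loses at most a constant factor, absorbed in the `3`.
  set K := (j - 1) / D.card with hK
  have hK1 : D.card * K ≤ j - 1 := Nat.mul_div_le _ _
  have hK2 : j - 1 < D.card * (K + 1) := Nat.lt_mul_div_succ _ hD
  have hK0 : 0 < K := Nat.div_pos (by omega) hD
  have hKj : j + 1 ≤ 3 * D.card * K := by
    have h := Nat.le_mul_of_pos_right D.card hK0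
    rw [mul_add] at hK2
    rw [mul_assoc]
    omega
  have hvar := gpVar_le_of_greedy hF.posSemidef hσ
    (sites (fun s => x s ω) (fun s => xt s ω))
    (fun t q => gpVar_le_gpVar_sample hσ hF hε hE hrun ω t q) hK0 (t := j) (by omega)
    (xt (j + 1) ω)
  have hK0' : (0 : ℝ) < K := by exact_mod_cast hK0
  have hKj' : ((j + 1 : ℕ) : ℝ) ≤ 3 * D.card * K := by exact_mod_cast hKj
  have hdiv : σ ^ 2 / K ≤ 3 * D.card * σ ^ 2 / (j + 1 : ℕ) := by
    rw [div_le_div_iff₀ hK0' (by positivity)]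
    nlinarith [sq_nonneg σ]
  have hle : beta D δ (j + 1) * gpVar k σ (sites (fun s => x s ω) (fun s => xt s ω)) j
      (xt (j + 1) ω) ≤ 3 * D.card * σ ^ 2 * (beta D δ (j + 1) / (j + 1 : ℕ)) :=
    (mul_le_mul_of_nonneg_left (hvar.trans hdiv) hβ0).trans_eq (by ring)
  rw [← Real.sqrt_mul hβ0]
  gcongr

end Run

end

end ORC

/-! ### The theorem. -/

theorem theorem1 {Ω : Type*} [MeasurableSpace Ω] (P : Measure Ω) [IsProbabilityMeasure P]
    (D : Finset ORC.Plane) (n : ℕ)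
    (m : D → ℝ) (k : D → D → ℝ) (hk : ∀ q q', k q q' ≤ 1)
    (F : D → Ω → ℝ) (hF : ORC.IsGP P m k F)
    (σ : ℝ) (hσ : 0 < σ) (δ : ℝ) (hδ : 0 < δ) (hδ' : δ ≤ 1)
    (E : ORC.Estimator) (hE : E.HasPrior m k)
    (x : ℕ → Ω → Fin n → D) (xt : ℕ → Ω → D) (ε : ℕ → Option (Fin n) → Ω → ℝ)
    (hε : ORC.IsNoise P σ F (x 0) ε)
    (hrun : ORC.IsRun E m k σ δ F ε x xt)
    (γ : ℕ → ℝ) (hγ : ∀ T, γ T = ORC.maxInfoGain (P.map fun ω q => F q ω) σ T) :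
    ENNReal.ofReal (1 - δ) ≤
      P {ω |
        (∀ T : ℕ, 1 ≤ T →
          ORC.cumRegret (fun q => F q ω) (fun t => x t ω) T ≤
            √(ORC.constOne D σ * (n + 1) * T * ORC.beta D δ T * γ T)) ∧
        (γ =O[atTop] (fun T : ℕ => (T : ℝ)) →
          Tendsto (fun T : ℕ => ORC.cumRegret (fun q => F q ω) (fun t => x t ω) T / T)
            atTop (𝓝 0))} := by
  -- A run provides a sampling location, so the domain is nonempty.
  have hD : 0 < D.card := by
    obtain ⟨ω⟩ := nonempty_of_isProbabilityMeasure P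
    exact Finset.card_pos.2 ⟨_, (xt 0 ω).2⟩
  have hsub : {ω | ORC.IsCalibrated m k σ δ F ε x xt ω} ⊆ {ω |
        (∀ T : ℕ, 1 ≤ T →
          ORC.cumRegret (fun q => F q ω) (fun t => x t ω) T ≤
            √(ORC.constOne D σ * (n + 1) * T * ORC.beta D δ T * γ T)) ∧
        (γ =O[atTop] (fun T : ℕ => (T : ℝ)) →
          Tendsto (fun T : ℕ => ORC.cumRegret (fun q => F q ω) (fun t => x t ω) T / T)
            atTop (𝓝 0))} := by
    intro ω hω
    refine ⟨fun T hT => ?_, fun _ => ?_⟩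
    · rw [hγ]
      exact ORC.cumRegret_le_of_isCalibrated hσ hδ hδ' hD hk hF hε hE hrun hω hT
    · simp only [ORC.cumRegret_eq_sum_range, div_eq_inv_mul]
      exact (ORC.tendsto_regret_of_isCalibrated hσ hδ hδ' hD hF hε hE hrun hω).cesaro
  refine le_trans ?_ (measure_mono hsub)
  have hbad := ORC.measure_not_isCalibrated_le hσ hδ hδ' hD hF hε hrun
  -- Subadditivity of the outer measure suffices, so measurability of the calibration event is never
  -- needed.
  have hone : 1 ≤ P {ω | ORC.IsCalibrated m k σ δ F ε x xt ω} +
      P {ω | ¬ ORC.IsCalibrated m k σ δ F ε x xt ω} := by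
    rw [← measure_univ (μ := P)]
    refine (measure_mono fun ω _ => ?_).trans (measure_union_le _ _)
    exact em _
  rw [ENNReal.ofReal_sub _ hδ.le, ENNReal.ofReal_one]
  exact tsub_le_iff_right.2 (hone.trans (by gcongr))
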